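/- For $N\ge 1$, an even weight $k\ge 4$ and $(a,b)\in(N^{-1}\mathbf Z/\mathbf Z)^2$ let $$E_k^{a,b}(z)=\sum_{(0,0)\ne(m,n)\in\mathbf Z^2}\frac{e^{2\pi i(an-bm)}}{(mz+n)^k}\qquad(\mathrm{Im}\, z>0).$$ For a congruence subgroup $\Gamma\le\Gamma(1)=\mathrm{SL}_2(\mathbf Z)$ of level $N$ (the least $N\ge 1$ with $\Gamma(N)\le\Gamma$) put $E_{k,\Gamma}^{a,b}=\sum_{g\in\Gamma(N)\backslash\Gamma}E_k^{(a,b)g}$. Let $$\mathcal F=\{z:\mathrm{Im}\, z>0,\ |z|>1,\ -\tfrac12\le\mathrm{Re}\, z<\tfrac12\}\cup\mathscr A,\qquad \mathscr A=\{e^{i\theta}:\pi/2\le\theta\le 2\pi/3\},$$ let $\overline{\mathcal F}$ be the closure of $\mathcal F$, and let $\mathscr A'=\{-\bar z: z\in\mathscr A\}$. Let $\overline Z_{k,\Gamma}$ be the set of all $z\in\overline{\mathcal F}$ with $E_{k,\gamma^{-1}\Gamma\gamma}^{a,b}(z)=0$ for some $(a,b)\in(N^{-1}\mathbf Z/\mathbf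 Z)^2$ and some $\gamma\in\Gamma(1)$. Let $\overline Z_{\infty,\Gamma}$ denote the limit of the sets $\overline Z_{k,\Gamma}$ as $k\to\infty$ through even integers, both in Hausdorff distance (Euclidean metric) and in the sense that it equals both the Kuratowski outer limit and the Kuratowski inner limit of these sets. Then for $\Gamma=\Gamma(N)$, $N\geq 1$, this limit exists, and: 1. If $4\nmid N$, then $\overline Z_{\infty,\Gamma(N)}=\mathscr A\cup\mathscr A'$. 2. If $4\mid N$ and $N\neq 4$, then $\overline Z_{\infty,\Gamma(N)}$ is the union of: the part of the boundary of $\overline{\mathcal F}$ lying below the circle $|z|=2$ (that is, with $|z|<2$); the part of the circle $|z|=2$ inside $\overline{\mathcal F}$; the points $z\in\overline{\mathcal F}$ with $|z-1|=2$ or $|z+1|=2$ and $\mathrm{Im}\, z\ge\sqrt3$; and the points $iy$ with $1\le y\le\sqrt3$. 3. If $N=4$, then $\overline Z_{\infty,\Gamma(4)}$ is the union of the same sets, except that the part of the boundary of $\overline{\mathcal F}$ with $|z|<2$ is replaced by $\mathscr A\cup\mathscr A'$ (the vertical boundary segments do not occur). -/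

import Mathlib

open Filter Topology
open scoped MatrixGroups

namespace EisZeros

/-- The left lower arc of the standard fundamental domain. -/
def leftArc : Set ℂ :=
  {z | ∃ θ : ℝ, Real.pi / 2 ≤ θ ∧ θ ≤ 2 * Real.pi / 3 ∧ z = Complex.exp (θ * Complex.I)}

/-- The right lower arc: the negative complex conjugate of the left one. -/
def rightArc : Set ℂ := (fun z : ℂ => -(starRingEnd ℂ) z) '' leftArc

/-- The standard fundamental domain for `SL(2, ℤ)`, as a subset of `ℂ`. -/
def fundDomain : Set ℂ :=
  {z | 0 < z.im ∧ 1 < ‖z‖ ∧ -(1 / 2) ≤ z.re ∧ z.re < 1 / 2} ∪ leftArc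

/-- The closed fundamental domain. -/
def closedFundDomain : Set ℂ := closure fundDomain

/-- The series `∑ e(a n - b m) / (m z + n) ^ k` over all pairs of integers
`(m, n) ≠ (0, 0)`, where `e(x) = exp (2 π i x)`; here `p = (m, n)`. It converges absolutely for
`k ≥ 3` and `z` in the upper half plane. -/
noncomputable def eisSeries (k : ℕ) (a b : ℝ) (z : ℂ) : ℂ :=
  ∑' p : {p : ℤ × ℤ // p ≠ (0, 0)},
    Complex.exp (2 * Real.pi * Complex.I * (a * (p.1.2 : ℂ) - b * (p.1.1 : ℂ))) /
      ((p.1.1 : ℂ) * z + (p.1.2 : ℂ)) ^ k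

/-- The Eisenstein series with index `(a, b) = (v 0 / N, v 1 / N)` in `(N⁻¹ℤ/ℤ)²`; the index is
given by the vector `v` of numerators modulo `N`. -/
noncomputable def eisIndex (N k : ℕ) (v : Fin 2 → ZMod N) (z : ℂ) : ℂ :=
  eisSeries k ((v 0).val / N) ((v 1).val / N) z

/-- The level of a congruence subgroup: the least `N ≥ 1` with `Γ(N) ≤ Γ`. -/
noncomputable def level (Γ : Subgroup SL(2, ℤ)) : ℕ :=
  sInf {N : ℕ | 0 < N ∧ CongruenceSubgroup.Gamma N ≤ Γ}

/-- The quotient `Γ(N) \ Γ`, realised as the image of `Γ` in `SL(2, ℤ/N)`. -/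
def reduction (N : ℕ) (Γ : Subgroup SL(2, ℤ)) : Subgroup SL(2, ZMod N) :=
  Γ.map (Matrix.SpecialLinearGroup.map (Int.castRingHom (ZMod N)))

/-- The trace modular form of weight `k` and index `v` for a group `Γ` containing `Γ(N)`:
the sum over `g` in `Γ(N) \ Γ` of the Eisenstein series with index the row vector `v g`. -/
noncomputable def traceForm (N k : ℕ) (Γ : Subgroup SL(2, ℤ)) (v : Fin 2 → ZMod N) (z : ℂ) : ℂ :=
  ∑ᶠ g : reduction N Γ, eisIndex N k (Matrix.vecMul v (g : SL(2, ZMod N)).1) z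

/-- The conjugate `γ⁻¹ Γ γ`. -/
def conjSubgroup (γ : SL(2, ℤ)) (Γ : Subgroup SL(2, ℤ)) : Subgroup SL(2, ℤ) :=
  Γ.map (MulAut.conj γ⁻¹).toMonoidHom

/-- The zeros in the closed fundamental domain of the weight `k` trace forms, with all indices
in `(N⁻¹ℤ/ℤ)²`, of all conjugates of `Γ` in `SL(2, ℤ)`. -/
def zerosOfLevel (N k : ℕ) (Γ : Subgroup SL(2, ℤ)) : Set ℂ :=
  {z | z ∈ closedFundDomain ∧
    ∃ (γ : SL(2, ℤ)) (v : Fin 2 → ZMod N), traceForm N k (conjSubgroup γ Γ) v z = 0}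

/-- The set of all zeros, in the closed fundamental domain, of the weight `k` Eisenstein series
attached to the congruence subgroup `Γ` and its conjugates. -/
noncomputable def zeroSet (k : ℕ) (Γ : Subgroup SL(2, ℤ)) : Set ℂ :=
  zerosOfLevel (level Γ) k Γ

/-- The outer limit (Kuratowski limit superior) of a sequence of sets. -/
def outerLimit (X : ℕ → Set ℂ) : Set ℂ :=
  {z | ∃ (φ : ℕ → ℕ) (w : ℕ → ℂ), Tendsto φ atTop atTop ∧ (∀ j, w j ∈ X (φ j)) ∧
    Tendsto w atTop (𝓝 z)}

/-- The inner limit (Kuratowski limit inferior) of a sequence of sets. -/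
def innerLimit (X : ℕ → Set ℂ) : Set ℂ :=
  {z | ∃ w : ℕ → ℂ, (∀ᶠ j in atTop, w j ∈ X j) ∧ Tendsto w atTop (𝓝 z)}

/-- `L` is the limit of the sets `X j`: they converge to `L` in Hausdorff distance, and `L` is
both their outer and their inner limit. -/
def IsSetLimit (X : ℕ → Set ℂ) (L : Set ℂ) : Prop :=
  Tendsto (fun j => Metric.hausdorffEDist (X j) L) atTop (𝓝 0) ∧
    outerLimit X = L ∧ innerLimit X = L

/-- `L` is the limit configuration of zeros for `Γ`, as the even weight `k ≥ 4` tends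
to infinity. -/
def IsLimitConfiguration (Γ : Subgroup SL(2, ℤ)) (L : Set ℂ) : Prop :=
  IsSetLimit (fun j => zeroSet (2 * (j + 2)) Γ) L

/-- The part of the boundary of the closed fundamental domain below the circle of radius `2`
centred at the origin. -/
def lowBoundary : Set ℂ := {z | z ∈ frontier closedFundDomain ∧ ‖z‖ < 2}

/-- The part in the closed fundamental domain of the circle of radius `2` centred at `0`. -/
def middleArc : Set ℂ := {z | z ∈ closedFundDomain ∧ ‖z‖ = 2}

/-- The parts in the closed fundamental domain, with imaginary part at least `√3`, of the two
circles of radius `2` centred at `1` and `-1`. -/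
def sideArcs : Set ℂ :=
  {z | z ∈ closedFundDomain ∧ (‖z - 1‖ = 2 ∨ ‖z + 1‖ = 2) ∧ √3 ≤ z.im}

/-- The points `i y` with `1 ≤ y ≤ √3`. -/
def imagSegment : Set ℂ := {z | ∃ y : ℝ, 1 ≤ y ∧ y ≤ √3 ∧ z = y * Complex.I}

end EisZeros

/-! In even weight k = 2l the terms at p = (m, n) and -p agree after pairing, so the series is a
lattice sum with real coefficients c(m, n) = cos(2π(an - bm)). For large l it is governed by the
forms mz + n of least absolute value among those with c ≠ 0. Where one pair ±q is strictly least
(`IsDominant`), there are no zeros nearby. Where two independent pairs tie, the quotient of the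
forms is exp s in a local coordinate s, the normalised sum is close to 1 + (c₂/c₁) exp(2ls), and
zeros accumulate at the tie (`eventually_exists_zero_near_tie`). So the limit consists of the tie
curves of the least surviving forms, over all (a, b). Since Γ(N) is normal and reduces to the
trivial group, conjugates and traces add nothing.

If cos 2πa ≠ 0, the form (0, 1) survives, and it is strictly least off the unit circle. This is
always the case when 4 ∤ N. If cos 2πa = 0, the forms (0, n) with n odd drop out and (0, 2) competes
with the forms (1, n). When sin 2πb = 0 only even n survive, and (1, 0) ties with (0, 2) on |z| = 2.
When cos 2πb = 0 only odd n survive, which gives |z ± 1| = 2 and, where (1, 1) ties with (1, -1),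
the imaginary axis. Otherwise (1, 0) and (1, ±1) all survive, and the vertical boundary lines occur
as well; this needs b outside ¼ℤ, hence N ≠ 4.

Ties on the boundary need more, since zeros must lie in the closed domain and not merely near it. On
the unit arc, and on the vertical lines for N = 8, a multiple of the sum is real along the tie curve
and changes sign (`eventually_exists_zero_on_tie`). On the vertical lines for larger N, the two
coefficients are chosen unequal so that the zeros fall on the inner side. -/

namespace EisZeros

/-! ### Set convergence from local data -/

/-- A local criterion for the convergence of sets: the sets stay in a compact set, they
eventually leave some neighbourhood of each point outside `L`, and they eventually meet every
neighbourhood of each point of `L`. -/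
theorem isSetLimit_of_local {X : ℕ → Set ℂ} {L K : Set ℂ} (hK : IsCompact K)
    (hXK : ∀ᶠ j in atTop, X j ⊆ K)
    (ha : ∀ z ∉ L, ∃ r > 0, ∀ᶠ j in atTop, Disjoint (X j) (Metric.ball z r))
    (hb : ∀ z ∈ L, ∀ ε > 0, ∀ᶠ j in atTop, (X j ∩ Metric.ball z ε).Nonempty) :
    IsSetLimit X L := by
  have hLc : IsClosed L := by
    rw [← isOpen_compl_iff, Metric.isOpen_iff]
    intro z hz
    obtain ⟨r, hr, h⟩ := ha z hz
    refine ⟨r, hr, fun w hw hwL => ?_⟩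
    obtain ⟨j, h1, h2⟩ := (h.and (hb w hwL (r - dist w z) (by simpa using hw))).exists
    obtain ⟨x, hx, hx'⟩ := h2
    refine Set.disjoint_left.1 h1 hx ?_
    rw [Metric.mem_ball] at *
    linarith [dist_triangle x w z]
  have hLK : L ⊆ K := by
    intro z hz
    rw [← hK.isClosed.closure_eq, Metric.mem_closure_iff]
    intro ε hε
    obtain ⟨j, h1, x, hx, hx'⟩ := (hXK.and (hb z hz ε hε)).exists
    exact ⟨x, h1 hx, by rwa [dist_comm]⟩
  have hL : IsCompact L := hK.of_isClosed_subset hLc hLK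
  have hnear : ∀ δ > 0, ∀ᶠ j in atTop, ∀ x ∈ X j, ∃ y ∈ L, dist x y < δ := by
    intro δ hδ
    -- Finitely many of the zero-free balls from `ha` cover this compact set.
    have key : ∀ᶠ j in atTop, Disjoint (X j) (K \ Metric.thickening δ L) := by
      refine (hK.diff Metric.isOpen_thickening).induction_on
        (p := fun s => ∀ᶠ j in atTop, Disjoint (X j) s) (by simp)
        (fun s t hst h => h.mono fun j hj => hj.mono_right hst)
        (fun s t hs ht => by
          filter_upwards [hs, ht] with j h1 h2 using Set.disjoint_union_right.2 ⟨h1, h2⟩) ?_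
      intro z hz
      obtain ⟨r, hr, h⟩ := ha z fun hzL => hz.2 (Metric.self_subset_thickening hδ L hzL)
      exact ⟨_, mem_nhdsWithin_of_mem_nhds (Metric.ball_mem_nhds z hr), h⟩
    filter_upwards [key, hXK] with j h1 h2 x hx
    by_contra hcon
    refine Set.disjoint_left.1 h1 hx ⟨h2 hx, fun hx' => hcon ?_⟩
    simpa [Metric.mem_thickening_iff] using hx'
  have hfar : ∀ δ > 0, ∀ᶠ j in atTop, ∀ y ∈ L, ∃ x ∈ X j, dist x y < δ := by
    intro δ hδ
    refine hL.induction_on (p := fun s => ∀ᶠ j in atTop, ∀ y ∈ s, ∃ x ∈ X j, dist x y < δ)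
      (by simp) (fun s t hst h => h.mono fun j hj y hy => hj y (hst hy))
      (fun s t hs ht => by
        filter_upwards [hs, ht] with j h1 h2 y hy using hy.elim (h1 y) (h2 y)) ?_
    intro z hz
    refine ⟨_, mem_nhdsWithin_of_mem_nhds (Metric.ball_mem_nhds z (half_pos hδ)), ?_⟩
    filter_upwards [hb z hz (δ / 2) (half_pos hδ)] with j ⟨x, hx, hxz⟩ y hy
    refine ⟨x, hx, ?_⟩
    rw [Metric.mem_ball] at *
    linarith [dist_triangle_right x y z]
  have hinner : ∀ z ∈ L, z ∈ innerLimit X := by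
    intro z hz
    -- The sets need not be closed, so a nearest point is replaced by one within 1/(j+1) of optimal;
    -- empty sets get the dummy value 0.
    have hex : ∀ j, ∃ x, ((X j).Nonempty → x ∈ X j ∧
        dist z x < Metric.infDist z (X j) + 1 / ((j : ℝ) + 1)) := by
      intro j
      by_cases hj : (X j).Nonempty
      · obtain ⟨x, hx, hlt⟩ := (Metric.infDist_lt_iff hj).1
          (lt_add_of_pos_right (Metric.infDist z (X j)) (Nat.one_div_pos_of_nat (n := j)))
        exact ⟨x, fun _ => ⟨hx, hlt⟩⟩
      · exact ⟨0, fun h => absurd h hj⟩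
    choose w hw using hex
    have hne : ∀ᶠ j in atTop, (X j).Nonempty :=
      (hb z hz 1 one_pos).mono fun j hj => hj.mono Set.inter_subset_left
    refine ⟨w, hne.mono fun j hj => (hw j hj).1, ?_⟩
    rw [Metric.tendsto_nhds]
    intro ε hε
    have h1 := (tendsto_one_div_add_atTop_nhds_zero_nat (𝕜 := ℝ)).eventually_lt_const (half_pos hε)
    filter_upwards [hne, h1, hb z hz (ε / 2) (half_pos hε)] with j h2 h3 ⟨x, hx, hxz⟩
    have h4 := (hw j h2).2
    have h5 : Metric.infDist z (X j) ≤ dist z x := Metric.infDist_le_dist_of_mem hx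
    rw [Metric.mem_ball, dist_comm] at hxz
    rw [dist_comm]
    linarith
  have houter : ∀ z ∈ outerLimit X, z ∈ L := by
    rintro z ⟨φ, w, hφ, hw, hwz⟩
    by_contra hz
    obtain ⟨r, hr, h⟩ := ha z hz
    obtain ⟨j, h1, h2⟩ := ((hφ.eventually h).and (hwz.eventually (Metric.ball_mem_nhds z hr))).exists
    exact Set.disjoint_left.1 h1 (hw j) h2
  have hio : innerLimit X ⊆ outerLimit X := by
    rintro z ⟨w, hw, hwz⟩
    obtain ⟨J, hJ⟩ := eventually_atTop.1 hw
    exact ⟨fun j => j + J, fun j => w (j + J), tendsto_add_atTop_nat J,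
      fun j => hJ _ (Nat.le_add_left J j), hwz.comp (tendsto_add_atTop_nat J)⟩
  refine ⟨?_, Set.Subset.antisymm houter fun z hz => hio (hinner z hz),
    Set.Subset.antisymm (fun z hz => houter z (hio hz)) hinner⟩
  rw [ENNReal.tendsto_nhds_zero]
  intro ε hε
  obtain ⟨δ, hδ0, hδ⟩ := ENNReal.lt_iff_exists_nnreal_btwn.1 hε
  have hδ' : (0 : ℝ) < δ := by exact_mod_cast hδ0
  filter_upwards [hnear δ hδ', hfar δ hδ'] with j h1 h2
  refine (Metric.hausdorffEDist_le_of_mem_edist (r := δ) (fun x hx => ?_) fun y hy => ?_).trans hδ.le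
  · obtain ⟨y, hy, h⟩ := h1 x hx
    refine ⟨y, hy, ?_⟩
    rw [edist_dist]
    exact ENNReal.ofReal_le_of_le_toReal (by simpa using h.le)
  · obtain ⟨x, hx, h⟩ := h2 y hy
    refine ⟨x, hx, ?_⟩
    rw [edist_dist, dist_comm]
    exact ENNReal.ofReal_le_of_le_toReal (by simpa using h.le)

/-! ### Linear forms and lattice sums -/

/-- The linear form `m z + n` attached to a lattice point `(m, n)`. -/
def linForm (p : ℤ × ℤ) (z : ℂ) : ℂ := (p.1 : ℂ) * z + p.2

theorem linForm_neg (p : ℤ × ℤ) (z : ℂ) : linForm (-p) z = -linForm p z := by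
  simp [linForm]; ring

theorem linForm_zero (z : ℂ) : linForm 0 z = 0 := by simp [linForm]

theorem continuous_linForm (p : ℤ × ℤ) : Continuous (linForm p) := by
  unfold linForm; fun_prop

theorem differentiable_linForm (p : ℤ × ℤ) : Differentiable ℂ (linForm p) := by
  unfold linForm; fun_prop

theorem linForm_ne_zero {p : ℤ × ℤ} (hp : p ≠ 0) {z : ℂ} (hz : 0 < z.im) : linForm p z ≠ 0 := by
  intro h
  have him := congrArg Complex.im h
  have hre := congrArg Complex.re h
  simp [linForm] at him hre
  rcases him with h1 | h1
  · apply hp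
    ext
    · exact h1
    · simpa [h1] using hre
  · exact hz.ne' h1

/-- This uniform bound on a truncated strip provides the summable majorant and leaves only finitely
many forms of bounded size. -/
theorem exists_mul_norm_le_norm_linForm (A : ℝ) {B : ℝ} (hB : 0 < B) :
    ∃ δ > 0, ∀ z : ℂ, |z.re| ≤ A → B ≤ z.im → ∀ p : ℤ × ℤ, δ * ‖p‖ ≤ ‖linForm p z‖ := by
  refine ⟨_, EisensteinSeries.r_pos ⟨⟨A, B⟩, hB⟩, fun z hre him p => ?_⟩
  rcases eq_or_ne p 0 with rfl | hp
  · simp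
  have hz : 0 < z.im := hB.trans_le him
  have hx : ![p.1, p.2] ≠ 0 := by
    intro h
    exact hp (Prod.ext (congrFun h 0) (congrFun h 1))
  have h1 := EisensteinSeries.r_mul_max_le ⟨z, hz⟩ hx
  have h2 := EisensteinSeries.r_lower_bound_on_verticalStrip (A := A) ⟨z, hz⟩ hB ⟨hre, him⟩
  have h3 : ‖p‖ = ‖![p.1, p.2]‖ := by
    rw [EisensteinSeries.norm_eq_max_natAbs, Prod.norm_def]
    simp [Int.norm_eq_abs]
  rw [h3]
  exact (mul_le_mul_of_nonneg_right h2 (norm_nonneg _)).trans h1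

theorem summable_inv_norm_pow_three : Summable fun p : ℤ × ℤ => (‖p‖ ^ 3)⁻¹ := by
  have h := EisensteinSeries.summable_one_div_norm_rpow (k := 3) (by norm_num)
  rw [← (finTwoArrowEquiv ℤ).symm.summable_iff] at h
  refine h.congr fun p => ?_
  have h3 : ‖p‖ = ‖![p.1, p.2]‖ := by
    rw [EisensteinSeries.norm_eq_max_natAbs, Prod.norm_def]
    simp [Int.norm_eq_abs]
  rw [h3, Function.comp, Real.rpow_neg (norm_nonneg _)]
  norm_cast

/-- The lattice sum `∑ c(p) / (m z + n) ^ (2 l)` over all `p = (m, n)`; the term with `p = 0`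
vanishes for `l ≥ 1`. -/
noncomputable def latticeSum (l : ℕ) (c : ℤ × ℤ → ℝ) (z : ℂ) : ℂ :=
  ∑' p : ℤ × ℤ, (c p : ℂ) / linForm p z ^ (2 * l)

theorem norm_div_linForm_pow_le {c : ℤ × ℤ → ℝ} (hc : ∀ p, |c p| ≤ 1) {δ : ℝ} (hδ : 0 < δ)
    {z : ℂ} (p : ℤ × ℤ) (h : δ * ‖p‖ ≤ ‖linForm p z‖) {k : ℕ} (hk : 3 ≤ k) :
    ‖(c p : ℂ) / linForm p z ^ k‖ ≤ (δ ^ k)⁻¹ * (‖p‖ ^ 3)⁻¹ := by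
  rcases eq_or_ne p 0 with rfl | hp
  · simp [linForm_zero, show k ≠ 0 by omega]
  have hp1 : 1 ≤ ‖p‖ := by
    rw [Prod.norm_def]
    by_contra hlt
    rw [not_le, max_lt_iff, Int.norm_eq_abs, Int.norm_eq_abs] at hlt
    have h1 : |p.1| < 1 := by exact_mod_cast hlt.1
    have h2 : |p.2| < 1 := by exact_mod_cast hlt.2
    exact hp (Prod.ext (Int.abs_lt_one_iff.1 h1) (Int.abs_lt_one_iff.1 h2))
  rw [norm_div, norm_pow, Complex.norm_real, ← mul_inv, ← one_div]
  refine div_le_div₀ zero_le_one (hc p) (by positivity) ?_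
  calc δ ^ k * ‖p‖ ^ 3 ≤ δ ^ k * ‖p‖ ^ k := by gcongr
    _ = (δ * ‖p‖) ^ k := by rw [mul_pow]
    _ ≤ _ := by gcongr

theorem summable_latticeSum {c : ℤ × ℤ → ℝ} (hc : ∀ p, |c p| ≤ 1) {l : ℕ} (hl : 2 ≤ l) {z : ℂ}
    (hz : 0 < z.im) : Summable fun p : ℤ × ℤ => (c p : ℂ) / linForm p z ^ (2 * l) := by
  obtain ⟨δ, hδ, h⟩ := exists_mul_norm_le_norm_linForm |z.re| hz
  exact .of_norm_bounded (summable_inv_norm_pow_three.mul_left (δ ^ (2 * l))⁻¹)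
    fun p => norm_div_linForm_pow_le hc hδ p (h z le_rfl le_rfl p) (by omega)

theorem ball_im_bounds {z₀ z : ℂ} {r : ℝ} (hz : z ∈ Metric.ball z₀ r) :
    |z.re| ≤ |z₀.re| + r ∧ z₀.im - r ≤ z.im := by
  rw [mem_ball_iff_norm] at hz
  have h1 := (Complex.abs_re_le_norm (z - z₀)).trans hz.le
  have h2 := (Complex.abs_im_le_norm (z - z₀)).trans hz.le
  rw [Complex.sub_re] at h1
  rw [Complex.sub_im] at h2
  constructor
  · have := abs_sub_abs_le_abs_sub z.re z₀.re
    linarith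
  · linarith [(abs_le.1 h2).1]

theorem differentiableAt_latticeSum {c : ℤ × ℤ → ℝ} (hc : ∀ p, |c p| ≤ 1) {l : ℕ} (hl : 2 ≤ l)
    {z : ℂ} (hz : 0 < z.im) : DifferentiableAt ℂ (latticeSum l c) z := by
  obtain ⟨δ, hδ, h⟩ := exists_mul_norm_le_norm_linForm (|z.re| + z.im / 2) (half_pos hz)
  have hb : ∀ w ∈ Metric.ball z (z.im / 2), |w.re| ≤ |z.re| + z.im / 2 ∧ z.im / 2 ≤ w.im := by
    intro w hw
    have := ball_im_bounds hw
    exact ⟨this.1, by linarith [this.2]⟩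
  have hd : DifferentiableOn ℂ (latticeSum l c) (Metric.ball z (z.im / 2)) := by
    refine Complex.differentiableOn_tsum_of_summable_norm
      (summable_inv_norm_pow_three.mul_left (δ ^ (2 * l))⁻¹) (fun p => ?_) Metric.isOpen_ball
      fun p w hw => norm_div_linForm_pow_le hc hδ p (h w (hb w hw).1 (hb w hw).2 p) (by omega)
    rcases eq_or_ne p 0 with rfl | hp
    · simp only [linForm_zero]
      fun_prop
    · intro w hw
      have hw0 : 0 < w.im := (half_pos hz).trans_le (hb w hw).2
      exact ((differentiableAt_const _).div ((differentiable_linForm p w).pow _)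
        (pow_ne_zero _ (linForm_ne_zero hp hw0))).differentiableWithinAt
  exact hd.differentiableAt (Metric.ball_mem_nhds z (half_pos hz))

/-! ### Domination by finitely many terms -/

/-- If all terms outside a finite set `S` are dominated by the linear form at `q`, uniformly on
`D`, then the normalised sum of these terms tends to zero uniformly on `D`. -/
theorem eventually_norm_latticeSum_sub_le {c : ℤ × ℤ → ℝ} (hc : ∀ p, |c p| ≤ 1) {D : Set ℂ}
    {A B M R : ℝ} (hB : 0 < B) (hR : 1 < R) (hre : ∀ z ∈ D, |z.re| ≤ A) (him : ∀ z ∈ D, B ≤ z.im)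
    {q : ℤ × ℤ} (hM : ∀ z ∈ D, ‖linForm q z‖ ≤ M) (S : Finset (ℤ × ℤ))
    (hS : ∀ z ∈ D, ∀ p ∉ S, p ≠ 0 → c p ≠ 0 → R * ‖linForm q z‖ ≤ ‖linForm p z‖)
    {ε : ℝ} (hε : 0 < ε) :
    ∀ᶠ l : ℕ in atTop, ∀ z ∈ D, ‖linForm q z ^ (2 * l) *
      (latticeSum l c z - ∑ p ∈ S, (c p : ℂ) / linForm p z ^ (2 * l))‖ ≤ ε := by
  obtain ⟨δ, hδ, hlow⟩ := exists_mul_norm_le_norm_linForm A hB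
  have hsum : Summable fun p : {p : ℤ × ℤ // p ∉ S} => (‖(p : ℤ × ℤ)‖ ^ 3)⁻¹ :=
    summable_inv_norm_pow_three.subtype {p | p ∉ S}
  set T := ∑' p : {p : ℤ × ℤ // p ∉ S}, (‖(p : ℤ × ℤ)‖ ^ 3)⁻¹
  have hlim : Tendsto (fun l : ℕ => (M / δ) ^ 3 * R⁻¹ ^ (2 * l - 3) * T) atTop (𝓝 0) := by
    have h1 : Tendsto (fun l : ℕ => R⁻¹ ^ (2 * l - 3)) atTop (𝓝 0) :=
      (tendsto_pow_atTop_nhds_zero_of_lt_one (by positivity) (inv_lt_one_of_one_lt₀ hR)).comp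
        (tendsto_atTop.2 fun b => eventually_atTop.2 ⟨b + 3, fun l hl => by omega⟩)
    simpa using (h1.const_mul ((M / δ) ^ 3)).mul_const T
  filter_upwards [hlim.eventually_le_const hε, eventually_ge_atTop 2] with l hl hl2 z hz
  refine le_trans ?_ hl
  have hz0 : 0 < z.im := hB.trans_le (him z hz)
  rw [latticeSum, ← (summable_latticeSum hc hl2 hz0).sum_add_tsum_subtype_compl S,
    add_sub_cancel_left, ← tsum_mul_left]
  refine tsum_of_norm_bounded (hsum.hasSum.mul_left _) ?_
  rintro ⟨p, hp⟩
  dsimp only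
  have hM0 : 0 ≤ M := (norm_nonneg _).trans (hM z hz)
  rcases eq_or_ne p 0 with rfl | hp0
  · simp [linForm_zero, show l ≠ 0 by omega]
  rcases eq_or_ne (c p) 0 with hcp | hcp
  · rw [hcp]
    simp only [Complex.ofReal_zero, zero_div, mul_zero, norm_zero]
    positivity
  have hlp : 0 < ‖linForm p z‖ := norm_pos_iff.2 (linForm_ne_zero hp0 hz0)
  have hnp : 0 < ‖p‖ := norm_pos_iff.2 hp0
  have h1 : ‖linForm q z‖ / ‖linForm p z‖ ≤ R⁻¹ := by
    rw [div_le_iff₀ hlp, inv_mul_eq_div, le_div_iff₀ (by positivity), mul_comm]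
    exact hS z hz p hp hp0 hcp
  have h2 : ‖linForm q z‖ / ‖linForm p z‖ ≤ M / (δ * ‖p‖) :=
    div_le_div₀ hM0 (hM z hz) (by positivity) (hlow z (hre z hz) (him z hz) p)
  -- Three factors of the quotient pay for summability over the lattice; the remaining 2l - 3 give
  -- geometric decay in l.
  have hexp : 2 * l = 3 + (2 * l - 3) := by omega
  calc ‖linForm q z ^ (2 * l) * ((c p : ℂ) / linForm p z ^ (2 * l))‖
      = |c p| * (‖linForm q z‖ / ‖linForm p z‖) ^ (2 * l) := by
        rw [norm_mul, norm_div, norm_pow, norm_pow, Complex.norm_real, Real.norm_eq_abs, div_pow]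
        ring
    _ ≤ 1 * (‖linForm q z‖ / ‖linForm p z‖) ^ (2 * l) := by gcongr; exact hc p
    _ = (‖linForm q z‖ / ‖linForm p z‖) ^ 3 * (‖linForm q z‖ / ‖linForm p z‖) ^ (2 * l - 3) := by
        rw [one_mul, ← pow_add, ← hexp]
    _ ≤ (M / (δ * ‖p‖)) ^ 3 * R⁻¹ ^ (2 * l - 3) := by gcongr
    _ = (M / δ) ^ 3 * R⁻¹ ^ (2 * l - 3) * (‖p‖ ^ 3)⁻¹ := by
        field_simp

/-- Strict domination at a point is uniform near that point. -/
theorem exists_ball_dominated {c : ℤ × ℤ → ℝ} {z₀ : ℂ} (hz₀ : 0 < z₀.im) {q : ℤ × ℤ}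
    {S : Finset (ℤ × ℤ)}
    (hS : ∀ p ∉ S, p ≠ 0 → c p ≠ 0 → ‖linForm q z₀‖ < ‖linForm p z₀‖) :
    ∃ r > 0, ∃ R > 1, ∀ z ∈ Metric.ball z₀ r, |z.re| ≤ |z₀.re| + 1 ∧ z₀.im / 2 ≤ z.im ∧
      ‖linForm q z‖ ≤ ‖linForm q z₀‖ + 1 ∧
      ∀ p ∉ S, p ≠ 0 → c p ≠ 0 → R * ‖linForm q z‖ ≤ ‖linForm p z‖ := by
  obtain ⟨δ, hδ, hlow⟩ := exists_mul_norm_le_norm_linForm (|z₀.re| + 1) (half_pos hz₀)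
  set M := ‖linForm q z₀‖ + 1 with hM
  -- Since R ≤ 2 below and |q(z)| ≤ M, all p outside this finite set are dominated automatically.
  have hfin : {p : ℤ × ℤ | δ * ‖p‖ < 2 * M}.Finite := by
    refine (Metric.finite_isBounded_inter_isClosed (s := Set.univ) (DiscreteTopology.isDiscrete)
      (Metric.isBounded_ball (x := (0 : ℤ × ℤ)) (r := 2 * M / δ)) isClosed_univ).subset ?_
    intro p hp
    simp only [Set.mem_ofPred_eq] at hp
    refine ⟨?_, Set.mem_univ _⟩
    rw [mem_ball_zero_iff, lt_div_iff₀ hδ, mul_comm]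
    exact hp
  -- The ratio R is treated as a variable near 1 together with z, so that continuity at (1, z₀)
  -- yields some R > 1 and a radius at once.
  have hpt : ∀ p ∈ {p : ℤ × ℤ | δ * ‖p‖ < 2 * M}, ∀ᶠ x : ℝ × ℂ in 𝓝 (1, z₀),
      p ∉ S → p ≠ 0 → c p ≠ 0 → x.1 * ‖linForm q x.2‖ < ‖linForm p x.2‖ := by
    intro p _
    by_cases hp : p ∉ S ∧ p ≠ 0 ∧ c p ≠ 0
    · have h1 : Tendsto (fun x : ℝ × ℂ => x.1 * ‖linForm q x.2‖) (𝓝 (1, z₀))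
          (𝓝 (1 * ‖linForm q z₀‖)) :=
        (continuous_fst.mul ((continuous_linForm q).comp continuous_snd).norm).tendsto (1, z₀)
      have h2 : Tendsto (fun x : ℝ × ℂ => ‖linForm p x.2‖) (𝓝 (1, z₀)) (𝓝 ‖linForm p z₀‖) :=
        ((continuous_linForm p).comp continuous_snd).norm.tendsto (1, z₀)
      filter_upwards [h1.eventually_lt h2 (by simpa using hS p hp.1 hp.2.1 hp.2.2)]
        with x hx _ _ _ using hx
    · exact Eventually.of_forall fun x h1 h2 h3 => absurd ⟨h1, h2, h3⟩ hp
  have hall := (Filter.eventually_all_finite hfin).2 hpt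
  have hqc : ∀ᶠ x : ℝ × ℂ in 𝓝 (1, z₀), ‖linForm q x.2‖ < M :=
    (((continuous_linForm q).comp continuous_snd).norm.tendsto (1, z₀)).eventually_lt_const
      (by simp [hM])
  obtain ⟨η, hη, hball⟩ := Metric.eventually_nhds_iff.1 (hall.and hqc)
  set R := 1 + min (η / 2) 1 with hR
  have hR1 : 0 < min (η / 2) 1 := by positivity
  refine ⟨min η (min 1 (z₀.im / 2)), by positivity, R, by linarith, fun z hz => ?_⟩
  have hzη : z ∈ Metric.ball z₀ η := Metric.ball_subset_ball (min_le_left _ _) hz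
  have h1 := (ball_im_bounds (Metric.ball_subset_ball (min_le_right _ _) hz))
  have hb1 : |z.re| ≤ |z₀.re| + 1 := h1.1.trans (by gcongr; exact min_le_left _ _)
  have hb2 : z₀.im / 2 ≤ z.im := by
    have := min_le_right 1 (z₀.im / 2)
    linarith [h1.2]
  have hx : dist ((R, z) : ℝ × ℂ) (1, z₀) < η := by
    rw [Prod.dist_eq, max_lt_iff]
    refine ⟨?_, hzη⟩
    rw [Real.dist_eq, hR, add_sub_cancel_left, abs_of_pos hR1]
    exact (min_le_left _ _).trans_lt (half_lt_self hη)
  obtain ⟨h3, h4⟩ := hball hx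
  refine ⟨hb1, hb2, h4.le, fun p hpS hp0 hcp => ?_⟩
  by_cases hp : δ * ‖p‖ < 2 * M
  · exact (h3 p hp hpS hp0 hcp).le
  · calc R * ‖linForm q z‖ ≤ 2 * M := by
          gcongr
          · exact (show R ≤ 2 by linarith [min_le_right (η / 2) 1])
      _ ≤ δ * ‖p‖ := not_lt.1 hp
      _ ≤ _ := hlow z hb1 hb2 p

/-- The local form of `eventually_norm_latticeSum_sub_le`. -/
theorem exists_ball_eventually_norm_latticeSum_sub_le {c : ℤ × ℤ → ℝ} (hc : ∀ p, |c p| ≤ 1)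
    {z₀ : ℂ} (hz₀ : 0 < z₀.im) {q : ℤ × ℤ} {S : Finset (ℤ × ℤ)}
    (hS : ∀ p ∉ S, p ≠ 0 → c p ≠ 0 → ‖linForm q z₀‖ < ‖linForm p z₀‖) :
    ∃ r > 0, (∀ z ∈ Metric.ball z₀ r, 0 < z.im) ∧ ∀ ε > 0, ∀ᶠ l : ℕ in atTop,
      ∀ z ∈ Metric.ball z₀ r, ‖linForm q z ^ (2 * l) *
        (latticeSum l c z - ∑ p ∈ S, (c p : ℂ) / linForm p z ^ (2 * l))‖ ≤ ε := by
  obtain ⟨r, hr, R, hR, h⟩ := exists_ball_dominated hz₀ hS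
  exact ⟨r, hr, fun z hz => (half_pos hz₀).trans_le (h z hz).2.1, fun ε hε =>
    eventually_norm_latticeSum_sub_le hc (half_pos hz₀) hR (fun z hz => (h z hz).1)
      (fun z hz => (h z hz).2.1) (fun z hz => (h z hz).2.2.1) S (fun z hz => (h z hz).2.2.2) hε⟩

theorem ne_neg_of_ne_zero {p : ℤ × ℤ} (hp : p ≠ 0) : p ≠ -p := by
  intro h
  have h1 := congrArg Prod.fst h
  have h2 := congrArg Prod.snd h
  simp only [Prod.fst_neg, Prod.snd_neg] at h1 h2
  exact hp (Prod.ext (by simp; omega) (by simp; omega))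

theorem sum_pair_neg {c : ℤ × ℤ → ℝ} (hcn : ∀ p, c (-p) = c p) {q : ℤ × ℤ} (hq : q ≠ 0) (l : ℕ)
    (z : ℂ) : ∑ p ∈ {q, -q}, (c p : ℂ) / linForm p z ^ (2 * l) =
      2 * (c q : ℂ) / linForm q z ^ (2 * l) := by
  rw [Finset.sum_pair (ne_neg_of_ne_zero hq), hcn, linForm_neg, (even_two_mul l).neg_pow]
  ring

/-- A single dominant pair of terms with nonzero coefficient excludes zeros. -/
theorem eventually_latticeSum_ne_zero {c : ℤ × ℤ → ℝ} (hcn : ∀ p, c (-p) = c p) {D : Set ℂ}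
    {q : ℤ × ℤ} (hq : q ≠ 0) (hcq : c q ≠ 0) (hD : ∀ z ∈ D, 0 < z.im)
    (h : ∀ ε > 0, ∀ᶠ l : ℕ in atTop, ∀ z ∈ D, ‖linForm q z ^ (2 * l) *
        (latticeSum l c z - ∑ p ∈ {q, -q}, (c p : ℂ) / linForm p z ^ (2 * l))‖ ≤ ε) :
    ∀ᶠ l : ℕ in atTop, ∀ z ∈ D, latticeSum l c z ≠ 0 := by
  -- The normalised main term has size 2|c q|, so an error of at most |c q| cannot cancel it.
  filter_upwards [h |c q| (abs_pos.2 hcq)] with l hl z hz h0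
  have h1 := hl z hz
  have hne : linForm q z ^ (2 * l) ≠ 0 := pow_ne_zero _ (linForm_ne_zero hq (hD z hz))
  rw [h0, sum_pair_neg hcn hq, zero_sub, mul_neg, mul_div_cancel₀ _ hne, norm_neg, norm_mul,
    Complex.norm_real, Real.norm_eq_abs] at h1
  norm_num at h1
  have := abs_pos.2 hcq
  linarith

/-! ### Zeros near a tie of two forms -/

/-- Small perturbations of `1 + a exp (2 l s)` have zeros near every point of the imaginary axis
once `l` is large. -/
theorem eventually_exists_zero_of_near_exp {h : ℕ → ℂ → ℂ} {a : ℂ} (ha : a ≠ 0) {τ₀ r : ℝ}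
    (hr : 0 < r)
    (hd : ∀ᶠ l : ℕ in atTop, DifferentiableOn ℂ (h l) (Metric.ball (τ₀ * Complex.I) r))
    (hh : ∀ ε > 0, ∀ᶠ l : ℕ in atTop, ∀ s ∈ Metric.ball (τ₀ * Complex.I) r,
      ‖h l s - (1 + a * Complex.exp (2 * l * s))‖ ≤ ε) :
    ∀ᶠ l : ℕ in atTop, ∃ s ∈ Metric.ball (τ₀ * Complex.I) r, h l s = 0 := by
  obtain ⟨μ, hμ⟩ : ∃ μ : ℂ, Complex.exp μ = -a⁻¹ :=
    ⟨Complex.log (-a⁻¹), Complex.exp_log (neg_ne_zero.2 (inv_ne_zero ha))⟩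
  have hlim : Tendsto (fun l : ℕ => (‖μ‖ + 2 * Real.pi + 1) / (l : ℝ)) atTop (𝓝 0) :=
    tendsto_const_div_atTop_nhds_zero_nat _
  filter_upwards [hd, hh (1 / 32) (by norm_num), hlim.eventually_lt_const hr,
    eventually_gt_atTop 0] with l hdl hl hlr hl0
  have hl0' : (0 : ℝ) < l := by exact_mod_cast hl0
  have hlc : (l : ℂ) ≠ 0 := by exact_mod_cast hl0.ne'
  have hpi := Real.pi_pos
  -- The model vanishes at the points (μ + 2πij)/(2l), spaced π/l apart; this j selects one, `s₁`,
  -- within O(1/l) of iτ₀.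
  set j : ℤ := ⌊l * τ₀ / Real.pi⌋ with hj
  have hj1 : |(j : ℝ) * Real.pi - l * τ₀| ≤ Real.pi := by
    have h1 := Int.floor_le (l * τ₀ / Real.pi)
    have h2 := (Int.lt_floor_add_one (l * τ₀ / Real.pi)).le
    rw [← hj] at h1 h2
    rw [le_div_iff₀ hpi] at h1
    rw [div_le_iff₀ hpi] at h2
    rw [abs_le]
    constructor <;> linarith
  set s₁ : ℂ := (μ + 2 * Real.pi * Complex.I * j) / (2 * l) with hs₁
  have hexp : ∀ t : ℂ, 1 + a * Complex.exp (2 * l * (s₁ + t / (2 * l))) = 1 - Complex.exp t := by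
    intro t
    have h1 : 2 * l * (s₁ + t / (2 * l)) = μ + j * (2 * Real.pi * Complex.I) + t := by
      rw [hs₁]; field_simp
    rw [h1, Complex.exp_add, Complex.exp_add, hμ, Complex.exp_int_mul_two_pi_mul_I]
    field_simp
    ring
  have hmem : ∀ t : ℂ, ‖t‖ ≤ 1 / 2 → s₁ + t / (2 * l) ∈ Metric.ball (τ₀ * Complex.I) r := by
    intro t ht
    rw [mem_ball_iff_norm]
    refine lt_of_le_of_lt ?_ hlr
    have h1 : s₁ + t / (2 * l) - τ₀ * Complex.I =
        (μ + t + 2 * (((j : ℝ) * Real.pi - l * τ₀ : ℝ) : ℂ) * Complex.I) / (2 * l) := by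
      rw [hs₁]; push_cast; field_simp; ring
    rw [h1, norm_div, div_le_div_iff₀ (by simpa using hl0) hl0']
    have h2 : ‖μ + t + 2 * (((j : ℝ) * Real.pi - l * τ₀ : ℝ) : ℂ) * Complex.I‖ ≤
        ‖μ‖ + 1 / 2 + 2 * Real.pi := by
      refine (norm_add_le _ _).trans (add_le_add ((norm_add_le _ _).trans ?_) ?_)
      · gcongr
      · rw [norm_mul, norm_mul, Complex.norm_I, Complex.norm_real, Real.norm_eq_abs]
        simpa using hj1
    have h3 : ‖(2 * l : ℂ)‖ = 2 * l := by simp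
    rw [h3]
    have h4 : ‖μ‖ + 1 / 2 + 2 * Real.pi ≤ (‖μ‖ + 2 * Real.pi + 1) * 2 := by
      linarith [norm_nonneg μ]
    calc _ ≤ ((‖μ‖ + 2 * Real.pi + 1) * 2) * l := by gcongr; exact h2.trans h4
      _ = _ := by ring
  by_contra! hno
  -- In the rescaled variable the model is 1 - exp t. On |t| = 1/2 it has size at least 1/2 - 1/4,
  -- so |g| ≥ 1/4 - 1/32 > 1/8 there, whereas |g(0)| ≤ 1/32. If g had no zero, this would contradict
  -- the maximum principle for 1/g.
  set g : ℂ → ℂ := fun t => h l (s₁ + t / (2 * l)) with hg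
  have hgd : DiffContOnCl ℂ g (Metric.ball 0 (1 / 2)) := by
    refine DifferentiableOn.diffContOnCl ?_
    rw [closure_ball _ (by norm_num)]
    refine hdl.comp (by fun_prop) fun t ht => hmem t (by simpa using ht)
  have hg0 : ∀ t ∈ closure (Metric.ball (0 : ℂ) (1 / 2)), g t ≠ 0 := by
    intro t ht
    rw [closure_ball _ (by norm_num)] at ht
    exact hno _ (hmem t (by simpa using ht))
  have hest : ∀ t : ℂ, ‖t‖ ≤ 1 / 2 → ‖g t - (1 - Complex.exp t)‖ ≤ 1 / 32 := by
    intro t ht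
    rw [← hexp t]
    exact hl _ (hmem t ht)
  have hbd : ∀ t ∈ frontier (Metric.ball (0 : ℂ) (1 / 2)), ‖g⁻¹ t‖ ≤ 8 := by
    intro t ht
    rw [frontier_ball _ (by norm_num), mem_sphere_zero_iff_norm] at ht
    have h1 := Complex.norm_exp_sub_one_sub_id_le (x := t) (by rw [ht]; norm_num)
    have h2 := hest t ht.le
    have h3 : ‖t‖ ≤ ‖g t‖ + ‖g t - (1 - Complex.exp t)‖ + ‖Complex.exp t - 1 - t‖ := by
      have : t = -(g t) + (g t - (1 - Complex.exp t)) - (Complex.exp t - 1 - t) := by ring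
      calc ‖t‖ = ‖-(g t) + (g t - (1 - Complex.exp t)) - (Complex.exp t - 1 - t)‖ := by rw [← this]
        _ ≤ ‖-(g t)‖ + ‖g t - (1 - Complex.exp t)‖ + ‖Complex.exp t - 1 - t‖ :=
          (norm_sub_le _ _).trans (by gcongr; exact norm_add_le _ _)
        _ = _ := by rw [norm_neg]
    rw [ht] at h1 h3
    rw [Pi.inv_apply, norm_inv]
    refine inv_le_of_inv_le₀ (by norm_num) ?_
    norm_num at h1 h2 h3 ⊢
    linarith
  have hmax := Complex.norm_le_of_forall_mem_frontier_norm_le Metric.isBounded_ball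
    (hgd.inv hg0) hbd (subset_closure (Metric.mem_ball_self (by norm_num : (0 : ℝ) < 1 / 2)))
  have h0 := hest 0 (by norm_num)
  have hne := hg0 0 (subset_closure (Metric.mem_ball_self (by norm_num)))
  rw [Complex.exp_zero, sub_self, sub_zero] at h0
  rw [Pi.inv_apply, norm_inv, inv_le_comm₀ (norm_pos_iff.2 hne) (by norm_num)] at hmax
  norm_num at h0 hmax
  linarith

/-- Near a point where two linear forms have equal absolute value, the quotient of the two forms
is the exponential of a local coordinate. -/
theorem exists_exp_coordinate {q₁ q₂ : ℤ × ℤ} (hdet : q₁.1 * q₂.2 - q₁.2 * q₂.1 ≠ 0) {z₀ : ℂ}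
    (hz₀ : 0 < z₀.im) (htie : ‖linForm q₁ z₀‖ = ‖linForm q₂ z₀‖) {r : ℝ} (hr : 0 < r) :
    ∃ (ψ : ℂ → ℂ) (τ₀ ρ : ℝ), 0 < ρ ∧ DifferentiableOn ℂ ψ (Metric.ball (τ₀ * Complex.I) ρ) ∧
      ∀ s ∈ Metric.ball (τ₀ * Complex.I) ρ, ψ s ∈ Metric.ball z₀ r ∧
        linForm q₁ (ψ s) = Complex.exp s * linForm q₂ (ψ s) := by
  have hq₂ : q₂ ≠ 0 := by rintro rfl; simp at hdet
  have h2 : linForm q₂ z₀ ≠ 0 := linForm_ne_zero hq₂ hz₀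
  obtain ⟨τ₀, hτ⟩ : ∃ τ₀ : ℝ, Complex.exp (τ₀ * Complex.I) = linForm q₁ z₀ / linForm q₂ z₀ := by
    refine ⟨(linForm q₁ z₀ / linForm q₂ z₀).arg, ?_⟩
    have := Complex.norm_mul_exp_arg_mul_I (linForm q₁ z₀ / linForm q₂ z₀)
    rwa [norm_div, htie, div_self (norm_ne_zero_iff.2 h2), Complex.ofReal_one, one_mul] at this
  have hdetc : (q₁.1 : ℂ) * q₂.2 - q₁.2 * q₂.1 ≠ 0 := by exact_mod_cast hdet
  set den : ℂ → ℂ := fun s => q₂.1 * Complex.exp s - q₁.1 with hden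
  -- This solves q₁(z) = exp(s) q₂(z), a linear equation in z. At iτ₀ the denominator is minus the
  -- determinant over q₂(z₀), hence nonzero.
  set ψ : ℂ → ℂ := fun s => (q₁.2 - Complex.exp s * q₂.2) / den s with hψ
  have hden0 : den (τ₀ * Complex.I) ≠ 0 := by
    have : den (τ₀ * Complex.I) = -((q₁.1 : ℂ) * q₂.2 - q₁.2 * q₂.1) / linForm q₂ z₀ := by
      simp only [hden]
      rw [hτ]
      field_simp
      simp only [linForm]
      ring
    rw [this]
    exact div_ne_zero (neg_ne_zero.2 hdetc) h2
  have hdenc : Continuous den := by simp only [hden]; fun_prop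
  have hψ0 : ψ (τ₀ * Complex.I) = z₀ := by
    simp only [hψ]
    rw [div_eq_iff hden0]
    simp only [hden]
    rw [hτ]
    field_simp
    simp only [linForm]
    ring
  have hdiff : ∀ s, den s ≠ 0 → DifferentiableAt ℂ ψ s := by
    intro s hs
    refine DifferentiableAt.div (by fun_prop) ?_ hs
    simp only [hden]
    fun_prop
  have hev : ∀ᶠ s in 𝓝 ((τ₀ : ℂ) * Complex.I), den s ≠ 0 ∧ ψ s ∈ Metric.ball z₀ r := by
    refine (hdenc.continuousAt.eventually_ne hden0).and ?_
    refine (hdiff _ hden0).continuousAt.eventually_mem ?_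
    rw [hψ0]
    exact Metric.ball_mem_nhds z₀ hr
  obtain ⟨ρ, hρ, hball⟩ := Metric.eventually_nhds_iff_ball.1 hev
  refine ⟨ψ, τ₀, ρ, hρ, fun s hs => (hdiff s (hball s hs).1).differentiableWithinAt,
    fun s hs => ⟨(hball s hs).2, ?_⟩⟩
  have hs0 := (hball s hs).1
  simp only [linForm, hψ]
  field_simp
  simp only [hden]
  ring

theorem sum_two_pairs {c : ℤ × ℤ → ℝ} (hcn : ∀ p, c (-p) = c p) {q₁ q₂ : ℤ × ℤ}
    (hdet : q₁.1 * q₂.2 - q₁.2 * q₂.1 ≠ 0) (l : ℕ) (z : ℂ) :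
    ∑ p ∈ {q₁, -q₁} ∪ {q₂, -q₂}, (c p : ℂ) / linForm p z ^ (2 * l) =
      2 * (c q₁ : ℂ) / linForm q₁ z ^ (2 * l) + 2 * (c q₂ : ℂ) / linForm q₂ z ^ (2 * l) := by
  have hq₁ : q₁ ≠ 0 := by rintro rfl; simp at hdet
  have hq₂ : q₂ ≠ 0 := by rintro rfl; simp at hdet
  have h1 : q₁ ≠ q₂ := by rintro rfl; exact hdet (by ring)
  have h2 : q₁ ≠ -q₂ := by
    rintro rfl
    exact hdet (by simp only [Prod.fst_neg, Prod.snd_neg]; ring)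
  rw [Finset.sum_union, sum_pair_neg hcn hq₁, sum_pair_neg hcn hq₂]
  rw [Finset.disjoint_left]
  intro p hp
  simp only [Finset.mem_insert, Finset.mem_singleton] at hp ⊢
  rintro (h3 | h3) <;> rcases hp with rfl | rfl
  · exact h1 h3
  · exact h2 (neg_eq_iff_eq_neg.1 h3)
  · exact h2 h3
  · exact h1 (neg_injective h3)

/-- Near a tie `|q₁(z₀)| = |q₂(z₀)|` of two dominant forms there are zeros. They lie on the side
of the tie curve where the form with the smaller coefficient is dominant. -/
theorem eventually_exists_zero_near_tie {c : ℤ × ℤ → ℝ} (hc : ∀ p, |c p| ≤ 1)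
    (hcn : ∀ p, c (-p) = c p) {q₁ q₂ : ℤ × ℤ} (hdet : q₁.1 * q₂.2 - q₁.2 * q₂.1 ≠ 0)
    (hc₁ : c q₁ ≠ 0) (hc₂ : c q₂ ≠ 0) {z₀ : ℂ} (hz₀ : 0 < z₀.im)
    (htie : ‖linForm q₁ z₀‖ = ‖linForm q₂ z₀‖)
    (hS : ∀ p ∉ ({q₁, -q₁} ∪ {q₂, -q₂} : Finset (ℤ × ℤ)), p ≠ 0 → c p ≠ 0 →
      ‖linForm q₁ z₀‖ < ‖linForm p z₀‖) {ε : ℝ} (hε : 0 < ε) :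
    ∀ᶠ l : ℕ in atTop, ∃ z ∈ Metric.ball z₀ ε, latticeSum l c z = 0 ∧
      (|c q₁| < |c q₂| → ‖linForm q₁ z‖ < ‖linForm q₂ z‖) := by
  have hq₁ : q₁ ≠ 0 := by rintro rfl; simp at hdet
  have hq₂ : q₂ ≠ 0 := by rintro rfl; simp at hdet
  obtain ⟨r, hr, him, hsmall⟩ := exists_ball_eventually_norm_latticeSum_sub_le hc hz₀ hS
  obtain ⟨ψ, τ₀, ρ, hρ, hψd, hψ⟩ := exists_exp_coordinate (r := min r ε)
    (q₁ := q₁) (q₂ := q₂) hdet hz₀ htie (lt_min hr hε)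
  have hψr : ∀ s ∈ Metric.ball ((τ₀ : ℂ) * Complex.I) ρ, ψ s ∈ Metric.ball z₀ r :=
    fun s hs => Metric.ball_subset_ball (min_le_left _ _) (hψ s hs).1
  have hc₁' : (c q₁ : ℂ) ≠ 0 := by exact_mod_cast hc₁
  have hc₂' : (c q₂ : ℂ) ≠ 0 := by exact_mod_cast hc₂
  have hexpand : ∀ l : ℕ, ∀ z ∈ Metric.ball z₀ r, linForm q₁ z ^ (2 * l) *
      (latticeSum l c z - ∑ p ∈ {q₁, -q₁} ∪ {q₂, -q₂}, (c p : ℂ) / linForm p z ^ (2 * l)) =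
      linForm q₁ z ^ (2 * l) * latticeSum l c z - 2 * c q₁ -
        2 * c q₂ * (linForm q₁ z / linForm q₂ z) ^ (2 * l) := by
    intro l z hz
    have h1 := linForm_ne_zero hq₁ (him z hz)
    have h2 := linForm_ne_zero hq₂ (him z hz)
    rw [sum_two_pairs hcn hdet, div_pow]
    field_simp
    ring
  have hzero := eventually_exists_zero_of_near_exp (a := c q₂ / c q₁) (τ₀ := τ₀) (r := ρ)
    (h := fun l s => linForm q₁ (ψ s) ^ (2 * l) * latticeSum l c (ψ s) / (2 * c q₁))
    (div_ne_zero hc₂' hc₁') hρ ?_ ?_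
  -- The tolerance is |c q₂| - |c q₁| when this is positive; the summand 1 only keeps it positive
  -- otherwise.
  · filter_upwards [hzero, hsmall (|(|c q₂| - |c q₁|)| + if |c q₁| < |c q₂| then 0 else 1)
      (by
        split_ifs with h
        · rw [add_zero]; exact abs_pos.2 (sub_pos.2 h).ne'
        · positivity)] with l ⟨s, hs, h0⟩ hl
    have h1 : linForm q₁ (ψ s) ≠ 0 := linForm_ne_zero hq₁ (him _ (hψr s hs))
    have h2 : linForm q₂ (ψ s) ≠ 0 := linForm_ne_zero hq₂ (him _ (hψr s hs))
    have hE : latticeSum l c (ψ s) = 0 := by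
      simpa [hc₁', h1] using h0
    refine ⟨ψ s, Metric.ball_subset_ball (min_le_right _ _) (hψ s hs).1, hE, fun hlt => ?_⟩
    have h3 := hl _ (hψr s hs)
    rw [hexpand l _ (hψr s hs), hE, if_pos hlt, add_zero, abs_of_pos (sub_pos.2 hlt)] at h3
    -- If |q₁| ≥ |q₂| at the zero, then 2|c q₂| ≤ 2|c q₁| + (|c q₂| - |c q₁|), which is impossible
    -- for |c q₁| < |c q₂|.
    by_contra! hge
    have h4 : 1 ≤ ‖linForm q₁ (ψ s) / linForm q₂ (ψ s)‖ := by
      rwa [norm_div, one_le_div (norm_pos_iff.2 h2)]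
    have h5 : ‖2 * (c q₂ : ℂ) * (linForm q₁ (ψ s) / linForm q₂ (ψ s)) ^ (2 * l)‖ ≤
        (|c q₂| - |c q₁|) + 2 * |c q₁| := by
      have h6 : 2 * (c q₂ : ℂ) * (linForm q₁ (ψ s) / linForm q₂ (ψ s)) ^ (2 * l) =
        -(linForm q₁ (ψ s) ^ (2 * l) * 0 - 2 * c q₁ -
          2 * c q₂ * (linForm q₁ (ψ s) / linForm q₂ (ψ s)) ^ (2 * l)) - 2 * c q₁ := by ring
      rw [h6]
      refine (norm_sub_le _ _).trans (add_le_add ?_ ?_)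
      · rwa [norm_neg]
      · simp
    rw [norm_mul, norm_mul, norm_pow, Complex.norm_real, Real.norm_eq_abs] at h5
    have h7 : |c q₂| ≤ |c q₂| * ‖linForm q₁ (ψ s) / linForm q₂ (ψ s)‖ ^ (2 * l) :=
      le_mul_of_one_le_right (abs_nonneg _) (one_le_pow₀ h4)
    norm_num at h5 h7
    linarith
  · filter_upwards [eventually_ge_atTop 2] with l hl s hs
    have hs' := hψr s hs
    have hψs : DifferentiableAt ℂ ψ s := hψd.differentiableAt (Metric.isOpen_ball.mem_nhds hs)
    have h1 : DifferentiableAt ℂ (fun s => latticeSum l c (ψ s)) s :=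
      (differentiableAt_latticeSum hc hl (him _ hs')).comp s hψs
    have h2 : DifferentiableAt ℂ (fun s => linForm q₁ (ψ s)) s :=
      (differentiable_linForm q₁ _).comp s hψs
    exact (((h2.pow _).mul h1).div_const _).differentiableWithinAt
  · intro η hη
    filter_upwards [hsmall (η * |c q₁|) (mul_pos hη (abs_pos.2 hc₁))] with l hl s hs
    have h1 := hl _ (hψr s hs)
    have h2 : linForm q₂ (ψ s) ≠ 0 := linForm_ne_zero hq₂ (him _ (hψr s hs))
    have h3 : linForm q₁ (ψ s) / linForm q₂ (ψ s) = Complex.exp s := by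
      rw [(hψ s hs).2, mul_div_cancel_right₀ _ h2]
    rw [hexpand l _ (hψr s hs), h3, ← Complex.exp_nat_mul] at h1
    have h4 : linForm q₁ (ψ s) ^ (2 * l) * latticeSum l c (ψ s) / (2 * c q₁) -
        (1 + c q₂ / c q₁ * Complex.exp (2 * l * s)) =
        (linForm q₁ (ψ s) ^ (2 * l) * latticeSum l c (ψ s) - 2 * c q₁ -
          2 * c q₂ * Complex.exp ((2 * l : ℕ) * s)) / (2 * c q₁) := by
      push_cast
      field_simp
      ring
    rw [h4, norm_div, norm_mul, Complex.norm_real, Real.norm_eq_abs]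
    have h5 := abs_pos.2 hc₁
    rw [div_le_iff₀ (mul_pos (by norm_num) h5)]
    refine h1.trans ?_
    norm_num
    nlinarith [mul_pos hη h5]

/-! ### Exact zeros on a tie curve via a real structure -/

/-- If complex conjugation acts on the linear forms at `z`, up to a common factor, by a
permutation that preserves the coefficients, then a suitable multiple of the lattice sum at `z`
is real. -/
theorem conj_mul_latticeSum {c : ℤ × ℤ → ℝ} (σ : ℤ × ℤ ≃ ℤ × ℤ) (hσc : ∀ p, c (σ p) = c p)
    {q₁ q₂ : ℤ × ℤ} (hq₁ : q₁ ≠ 0) {z : ℂ} (hz : 0 < z.im) {t : ℂ}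
    (ht : ∀ p, (starRingEnd ℂ) (linForm p z) = t * linForm (σ p) z)
    (hprod : linForm (σ q₁) z * linForm (σ q₂) z = linForm q₁ z * linForm q₂ z) (l : ℕ) :
    (starRingEnd ℂ) ((linForm q₁ z * linForm q₂ z) ^ l * latticeSum l c z) =
      (linForm q₁ z * linForm q₂ z) ^ l * latticeSum l c z := by
  have ht0 : t ≠ 0 := by
    rintro rfl
    have := ht q₁
    rw [zero_mul, map_eq_zero] at this
    exact linForm_ne_zero hq₁ hz this
  have h1 : (starRingEnd ℂ) (latticeSum l c z) = (t ^ (2 * l))⁻¹ * latticeSum l c z := by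
    rw [latticeSum, Complex.conj_tsum, ← tsum_mul_left,
      ← σ.tsum_eq fun p => (t ^ (2 * l))⁻¹ * ((c p : ℂ) / linForm p z ^ (2 * l))]
    refine tsum_congr fun p => ?_
    rw [map_div₀, map_pow, ht, Complex.conj_ofReal, hσc, mul_pow, div_mul_eq_div_div,
      div_eq_inv_mul (c p : ℂ), mul_div_assoc]
  rw [map_mul, map_pow, map_mul, h1, ht, ht]
  have h2 : t * linForm (σ q₁) z * (t * linForm (σ q₂) z) =
      t ^ 2 * (linForm q₁ z * linForm q₂ z) := by
    rw [← hprod]; ring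
  rw [h2, mul_pow, ← pow_mul]
  field_simp

/-- Near a tie of two dominant forms with equal coefficients there are zeros exactly on the tie
curve, provided that the lattice sum has a real structure there. -/
theorem eventually_exists_zero_on_tie {c : ℤ × ℤ → ℝ} (hc : ∀ p, |c p| ≤ 1)
    (hcn : ∀ p, c (-p) = c p) {q₁ q₂ : ℤ × ℤ} (hdet : q₁.1 * q₂.2 - q₁.2 * q₂.1 ≠ 0)
    (hc₁ : c q₁ ≠ 0) (hc₂ : c q₂ = c q₁) (σ : ℤ × ℤ ≃ ℤ × ℤ) (hσc : ∀ p, c (σ p) = c p)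
    (hσ : ∀ z : ℂ, 0 < z.im → ‖linForm q₁ z‖ = ‖linForm q₂ z‖ →
      ∃ t : ℂ, ∀ p, (starRingEnd ℂ) (linForm p z) = t * linForm (σ p) z)
    (hprod : ∀ z, linForm (σ q₁) z * linForm (σ q₂) z = linForm q₁ z * linForm q₂ z)
    {z₀ : ℂ} (hz₀ : 0 < z₀.im) (htie : ‖linForm q₁ z₀‖ = ‖linForm q₂ z₀‖)
    (hS : ∀ p ∉ ({q₁, -q₁} ∪ {q₂, -q₂} : Finset (ℤ × ℤ)), p ≠ 0 → c p ≠ 0 →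
      ‖linForm q₁ z₀‖ < ‖linForm p z₀‖) {ε : ℝ} (hε : 0 < ε) :
    ∀ᶠ l : ℕ in atTop, ∃ z ∈ Metric.ball z₀ ε, latticeSum l c z = 0 ∧
      ‖linForm q₁ z‖ = ‖linForm q₂ z‖ := by
  have hq₁ : q₁ ≠ 0 := by rintro rfl; simp at hdet
  have hq₂ : q₂ ≠ 0 := by rintro rfl; simp at hdet
  obtain ⟨r, hr, him, hsmall⟩ := exists_ball_eventually_norm_latticeSum_sub_le hc hz₀ hS
  obtain ⟨ψ, τ₀, ρ, hρ, hψd, hψ⟩ := exists_exp_coordinate (r := min r ε)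
    (q₁ := q₁) (q₂ := q₂) hdet hz₀ htie (lt_min hr hε)
  have hψr : ∀ s ∈ Metric.ball ((τ₀ : ℂ) * Complex.I) ρ, ψ s ∈ Metric.ball z₀ r :=
    fun s hs => Metric.ball_subset_ball (min_le_left _ _) (hψ s hs).1
  have hmem : ∀ τ : ℝ, |τ - τ₀| < ρ → (τ : ℂ) * Complex.I ∈ Metric.ball ((τ₀ : ℂ) * Complex.I) ρ := by
    intro τ hτ
    rw [mem_ball_iff_norm, ← sub_mul, norm_mul, Complex.norm_I, mul_one, ← Complex.ofReal_sub,
      Complex.norm_real]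
    exact hτ
  have hnorm : ∀ τ : ℝ, |τ - τ₀| < ρ →
      ‖linForm q₁ (ψ (τ * Complex.I))‖ = ‖linForm q₂ (ψ (τ * Complex.I))‖ := by
    intro τ hτ
    rw [(hψ _ (hmem τ hτ)).2, norm_mul, Complex.norm_exp_ofReal_mul_I, one_mul]
  have hpi := Real.pi_pos
  have hlim : Tendsto (fun l : ℕ => Real.pi / (l : ℝ)) atTop (𝓝 0) :=
    tendsto_const_div_atTop_nhds_zero_nat _
  filter_upwards [hsmall |c q₁| (abs_pos.2 hc₁), hlim.eventually_lt_const hρ,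
    eventually_ge_atTop 2] with l hl hlρ hl2
  have hl0 : (0 : ℝ) < l := by exact_mod_cast (by omega : 0 < l)
  set G : ℝ → ℂ := fun τ => (linForm q₁ (ψ (τ * Complex.I)) * linForm q₂ (ψ (τ * Complex.I))) ^ l *
    latticeSum l c (ψ (τ * Complex.I)) with hG
  -- On the tie curve q₁/q₂ = exp(iτ), so the factor (q₁q₂)^l turns the two main terms into
  -- 2c(exp(ilτ) + exp(-ilτ)).
  have hGest : ∀ τ : ℝ, |τ - τ₀| < ρ → |(G τ).re - 4 * c q₁ * Real.cos (l * τ)| ≤ |c q₁| := by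
    intro τ hτ
    have hs := hψr _ (hmem τ hτ)
    have h1 := hl _ hs
    set z := ψ (τ * Complex.I) with hz
    have hz1 : linForm q₁ z ≠ 0 := linForm_ne_zero hq₁ (him _ hs)
    have hz2 : linForm q₂ z ≠ 0 := linForm_ne_zero hq₂ (him _ hs)
    have h3 : linForm q₁ z = Complex.exp (τ * Complex.I) * linForm q₂ z := (hψ _ (hmem τ hτ)).2
    set e := Complex.exp (τ * Complex.I) with he
    have he0 : e ≠ 0 := Complex.exp_ne_zero _
    have hen : ‖e‖ = 1 := Complex.norm_exp_ofReal_mul_I τ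
    have h4 : G τ - 4 * c q₁ * Complex.cos (l * τ) = (e ^ l)⁻¹ * (linForm q₁ z ^ (2 * l) *
        (latticeSum l c z -
          ∑ p ∈ {q₁, -q₁} ∪ {q₂, -q₂}, (c p : ℂ) / linForm p z ^ (2 * l))) := by
      have h5 : Complex.cos (l * τ) = (e ^ l + (e ^ l)⁻¹) / 2 := by
        rw [Complex.cos, he, ← Complex.exp_nat_mul, ← Complex.exp_neg]
        ring_nf
      rw [sum_two_pairs hcn hdet, hc₂, h5]
      simp only [hG]
      rw [← hz, h3]
      rw [h3] at hz1
      field_simp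
      ring
    have h6 : (G τ).re - 4 * c q₁ * Real.cos (l * τ) =
        (G τ - 4 * c q₁ * Complex.cos (l * τ)).re := by
      have : (4 * c q₁ * Complex.cos (l * τ) : ℂ) = ((4 * c q₁ * Real.cos (l * τ) : ℝ) : ℂ) := by
        push_cast; ring
      rw [this, Complex.sub_re, Complex.ofReal_re]
    rw [h6]
    refine (Complex.abs_re_le_norm _).trans ?_
    rw [h4, norm_mul, norm_inv, norm_pow, hen, one_pow, inv_one, one_mul]
    exact h1
  set j : ℤ := ⌊l * τ₀ / Real.pi⌋ with hj
  have hj1 := Int.floor_le (l * τ₀ / Real.pi)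
  have hj2 := Int.lt_floor_add_one (l * τ₀ / Real.pi)
  rw [← hj] at hj1 hj2
  rw [le_div_iff₀ hpi] at hj1
  rw [div_lt_iff₀ hpi] at hj2
  -- At the consecutive multiples of π/l around τ₀ the cosine is ±1 with opposite signs, so the main
  -- term 4c beats the error |c| and Re G changes sign.
  set a := j * Real.pi / l with ha
  set b := ((j + 1 : ℤ) : ℝ) * Real.pi / l with hb
  have hab : b = a + Real.pi / l := by
    rw [ha, hb]; push_cast; ring
  have ha1 : a ≤ τ₀ := by
    rw [ha, div_le_iff₀ hl0]; linarith
  have hb1 : τ₀ ≤ b := by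
    rw [hb, le_div_iff₀ hl0]; push_cast; linarith
  have hpl : 0 < Real.pi / l := by positivity
  have hin : ∀ τ ∈ Set.uIcc a b, |τ - τ₀| < ρ := by
    intro τ hτ
    rw [Set.uIcc_of_le (by linarith)] at hτ
    rw [abs_lt]
    constructor <;> linarith [hτ.1, hτ.2]
  have hcont : ContinuousOn (fun τ => (G τ).re) (Set.uIcc a b) := by
    intro τ hτ
    have hτ' := hmem τ (hin τ hτ)
    have h1 : ContinuousAt (fun τ : ℝ => ψ (τ * Complex.I)) τ :=
      (hψd.continuousOn.continuousAt (Metric.isOpen_ball.mem_nhds hτ')).comp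
        (f := fun τ : ℝ => (τ : ℂ) * Complex.I) (by fun_prop)
    have h2 : ContinuousAt (fun τ : ℝ => latticeSum l c (ψ (τ * Complex.I))) τ :=
      ContinuousAt.comp (g := latticeSum l c) (f := fun τ : ℝ => ψ (τ * Complex.I))
        (differentiableAt_latticeSum hc hl2 (him _ (hψr _ hτ'))).continuousAt h1
    have h3 : ∀ q, ContinuousAt (fun τ : ℝ => linForm q (ψ (τ * Complex.I))) τ :=
      fun q => ContinuousAt.comp (g := linForm q) (f := fun τ : ℝ => ψ (τ * Complex.I))
        (continuous_linForm q).continuousAt h1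
    exact (Complex.continuous_re.continuousAt.comp
      ((((h3 q₁).mul (h3 q₂)).pow l).mul h2)).continuousWithinAt
  have hGa := hGest a (hin a Set.left_mem_uIcc)
  have hGb := hGest b (hin b Set.right_mem_uIcc)
  have hca : Real.cos (l * a) = (-1) ^ j := by
    rw [ha, mul_div_cancel₀ _ hl0.ne', Real.cos_int_mul_pi]
  have hcb : Real.cos (l * b) = -(-1) ^ j := by
    rw [hb, mul_div_cancel₀ _ hl0.ne', Real.cos_int_mul_pi, zpow_add_one₀ (by norm_num)]
    ring
  rw [hca] at hGa
  rw [hcb] at hGb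
  have hzero : (0 : ℝ) ∈ Set.uIcc (G a).re (G b).re := by
    rw [Set.mem_uIcc]
    rw [abs_le] at hGa hGb
    have hpos := abs_pos.2 hc₁
    rcases Int.even_or_odd j with he | he
    · rw [he.neg_one_zpow] at hGa hGb
      rcases abs_cases (c q₁) with h | h
      · right; constructor <;> linarith
      · left; constructor <;> linarith
    · rw [he.neg_one_zpow] at hGa hGb
      rcases abs_cases (c q₁) with h | h
      · left; constructor <;> linarith
      · right; constructor <;> linarith
  obtain ⟨τ, hτ, h0⟩ := intermediate_value_uIcc hcont hzero
  have hτρ := hin τ hτ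
  have hs := hψr _ (hmem τ hτρ)
  -- The real structure makes G real here, so the zero of its real part is a zero of G.
  obtain ⟨t, ht⟩ := hσ _ (him _ hs) (hnorm τ hτρ)
  have hreal := conj_mul_latticeSum σ hσc hq₁ (him _ hs) ht (hprod _) (q₂ := q₂) l
  rw [Complex.conj_eq_iff_im] at hreal
  have hG0 : G τ = 0 := Complex.ext h0 hreal
  refine ⟨ψ (τ * Complex.I), Metric.ball_subset_ball (min_le_right _ _) (hψ _ (hmem τ hτρ)).1, ?_,
    hnorm τ hτρ⟩
  simp only [hG] at hG0
  have hz1 : linForm q₁ (ψ (τ * Complex.I)) ≠ 0 := linForm_ne_zero hq₁ (him _ hs)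
  have hz2 : linForm q₂ (ψ (τ * Complex.I)) ≠ 0 := linForm_ne_zero hq₂ (him _ hs)
  exact (mul_eq_zero.1 hG0).resolve_left (pow_ne_zero _ (mul_ne_zero hz1 hz2))

/-! ### The fundamental domain in real coordinates -/

theorem norm_linForm_sq (p : ℤ × ℤ) (z : ℂ) :
    ‖linForm p z‖ ^ 2 = (p.1 * z.re + p.2) ^ 2 + (p.1 * z.im) ^ 2 := by
  rw [Complex.sq_norm, Complex.normSq_apply]
  simp [linForm]
  ring

theorem norm_linForm_lt_iff {p q : ℤ × ℤ} {z : ℂ} : ‖linForm p z‖ < ‖linForm q z‖ ↔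
    (p.1 * z.re + p.2) ^ 2 + (p.1 * z.im) ^ 2 < (q.1 * z.re + q.2) ^ 2 + (q.1 * z.im) ^ 2 := by
  rw [← norm_linForm_sq, ← norm_linForm_sq, sq_lt_sq₀ (norm_nonneg _) (norm_nonneg _)]

theorem norm_linForm_eq_iff {p q : ℤ × ℤ} {z : ℂ} : ‖linForm p z‖ = ‖linForm q z‖ ↔
    (p.1 * z.re + p.2) ^ 2 + (p.1 * z.im) ^ 2 = (q.1 * z.re + q.2) ^ 2 + (q.1 * z.im) ^ 2 := by
  rw [← norm_linForm_sq, ← norm_linForm_sq, sq_eq_sq₀ (norm_nonneg _) (norm_nonneg _)]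

theorem norm_sq_eq (z : ℂ) : ‖z‖ ^ 2 = z.re ^ 2 + z.im ^ 2 := by
  rw [Complex.sq_norm, Complex.normSq_apply]; ring

theorem norm_lt_iff_sq {z : ℂ} {r : ℝ} (hr : 0 ≤ r) : ‖z‖ < r ↔ z.re ^ 2 + z.im ^ 2 < r ^ 2 := by
  rw [← norm_sq_eq, sq_lt_sq₀ (norm_nonneg _) hr]

theorem norm_eq_iff_sq {z : ℂ} {r : ℝ} (hr : 0 ≤ r) : ‖z‖ = r ↔ z.re ^ 2 + z.im ^ 2 = r ^ 2 := by
  rw [← norm_sq_eq, sq_eq_sq₀ (norm_nonneg _) hr]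

theorem lt_norm_iff_sq {z : ℂ} {r : ℝ} (hr : 0 ≤ r) : r < ‖z‖ ↔ r ^ 2 < z.re ^ 2 + z.im ^ 2 := by
  rw [← norm_sq_eq, sq_lt_sq₀ hr (norm_nonneg _)]

theorem mem_leftArc_iff {z : ℂ} : z ∈ leftArc ↔
    0 < z.im ∧ -(1 / 2) ≤ z.re ∧ z.re ≤ 0 ∧ z.re ^ 2 + z.im ^ 2 = 1 := by
  have hpi := Real.pi_pos
  constructor
  · rintro ⟨θ, h1, h2, rfl⟩
    rw [Complex.exp_ofReal_mul_I_re, Complex.exp_ofReal_mul_I_im]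
    refine ⟨Real.sin_pos_of_pos_of_lt_pi (by linarith) (by linarith), ?_, ?_, ?_⟩
    · have h3 : Real.cos (2 * Real.pi / 3) = -(1 / 2) := by
        rw [show 2 * Real.pi / 3 = Real.pi - Real.pi / 3 by ring, Real.cos_pi_sub,
          Real.cos_pi_div_three]
      rw [← h3]
      exact Real.cos_le_cos_of_nonneg_of_le_pi (by linarith) (by linarith) h2
    · rw [← Real.cos_pi_div_two]
      exact Real.cos_le_cos_of_nonneg_of_le_pi (by linarith) (by linarith) h1
    · exact Real.cos_sq_add_sin_sq θ
  · rintro ⟨him, h1, h2, h3⟩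
    refine ⟨Real.arccos z.re, ?_, ?_, ?_⟩
    · rw [← Real.arccos_zero]
      exact Real.arccos_le_arccos h2
    · have h4 : Real.arccos (-(1 / 2)) = 2 * Real.pi / 3 := by
        rw [Real.arccos_neg, ← Real.cos_pi_div_three,
          Real.arccos_cos (by positivity) (by linarith)]
        ring
      rw [← h4]
      exact Real.arccos_le_arccos h1
    · apply Complex.ext
      · rw [Complex.exp_ofReal_mul_I_re, Real.cos_arccos (by linarith) (by linarith)]
      · rw [Complex.exp_ofReal_mul_I_im, Real.sin_arccos,
          show 1 - z.re ^ 2 = z.im ^ 2 by linarith, Real.sqrt_sq him.le]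

theorem mem_closedFundDomain_iff {z : ℂ} : z ∈ closedFundDomain ↔
    0 < z.im ∧ |z.re| ≤ 1 / 2 ∧ 1 ≤ z.re ^ 2 + z.im ^ 2 := by
  have hclosed : IsClosed {z : ℂ | 0 ≤ z.im ∧ |z.re| ≤ 1 / 2 ∧ 1 ≤ z.re ^ 2 + z.im ^ 2} := by
    refine IsClosed.and ?_ (IsClosed.and ?_ ?_)
    · exact isClosed_le continuous_const Complex.continuous_im
    · exact isClosed_le Complex.continuous_re.abs continuous_const
    · exact isClosed_le continuous_const
        ((Complex.continuous_re.pow 2).add (Complex.continuous_im.pow 2))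
  constructor
  · intro hz
    have hsub : fundDomain ⊆ {z : ℂ | 0 ≤ z.im ∧ |z.re| ≤ 1 / 2 ∧ 1 ≤ z.re ^ 2 + z.im ^ 2} := by
      rintro w (⟨h1, h2, h3, h4⟩ | hw)
      · rw [lt_norm_iff_sq zero_le_one] at h2
        exact ⟨h1.le, abs_le.2 ⟨h3, h4.le⟩, by linarith⟩
      · obtain ⟨h1, h2, h3, h4⟩ := mem_leftArc_iff.1 hw
        exact ⟨h1.le, abs_le.2 ⟨h2, by linarith⟩, h4.ge⟩
    obtain ⟨h1, h2, h3⟩ := closure_minimal hsub hclosed hz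
    refine ⟨h1.lt_of_ne' fun h0 => ?_, h2, h3⟩
    rw [h0] at h3
    nlinarith [sq_abs z.re, abs_nonneg z.re]
  · rintro ⟨him, hre, hn⟩
    rw [abs_le] at hre
    -- Shrinking the real part and raising the imaginary part moves every boundary point strictly
    -- inside.
    have hw : Tendsto (fun t : ℝ => (⟨z.re * (1 - t), z.im + t⟩ : ℂ)) (𝓝[>] 0) (𝓝 z) := by
      have h1 : Continuous fun t : ℝ => ((z.re * (1 - t) : ℝ) : ℂ) + (z.im + t : ℝ) * Complex.I := by
        fun_prop
      have h2 := (h1.tendsto 0).mono_left (nhdsWithin_le_nhds (s := Set.Ioi 0))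
      simp only [← Complex.mk_eq_add_mul_I, sub_zero, mul_one, add_zero] at h2
      exact h2
    refine mem_closure_of_tendsto hw ?_
    filter_upwards [Ioo_mem_nhdsGT one_pos] with t ht
    left
    have h34 : 3 / 4 ≤ z.im ^ 2 := by nlinarith
    have him2 : 1 / 2 ≤ z.im := by nlinarith
    refine ⟨by simp only; linarith [ht.1], ?_, ?_, ?_⟩
    · rw [lt_norm_iff_sq zero_le_one]
      simp only
      have h5 : z.re ^ 2 ≤ 1 / 4 := by nlinarith
      have : (z.re * (1 - t)) ^ 2 + (z.im + t) ^ 2 =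
        z.re ^ 2 + z.im ^ 2 + t * (2 * z.im - 2 * z.re ^ 2) + t ^ 2 * (1 + z.re ^ 2) := by ring
      rw [this]
      have h6 : 0 < t * (2 * z.im - 2 * z.re ^ 2) := mul_pos ht.1 (by linarith)
      have h7 : 0 < t ^ 2 * (1 + z.re ^ 2) := mul_pos (pow_pos ht.1 2) (by positivity)
      linarith
    · simp only
      nlinarith [ht.1, ht.2]
    · simp only
      nlinarith [ht.1, ht.2]

theorem mem_arcs_iff {z : ℂ} : z ∈ leftArc ∪ rightArc ↔
    0 < z.im ∧ |z.re| ≤ 1 / 2 ∧ z.re ^ 2 + z.im ^ 2 = 1 := by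
  constructor
  · rintro (h | ⟨w, hw, rfl⟩)
    · obtain ⟨h1, h2, h3, h4⟩ := mem_leftArc_iff.1 h
      exact ⟨h1, abs_le.2 ⟨h2, by linarith⟩, h4⟩
    · obtain ⟨h1, h2, h3, h4⟩ := mem_leftArc_iff.1 hw
      simp only [Complex.neg_re, Complex.conj_re, Complex.neg_im, Complex.conj_im, neg_neg]
      exact ⟨h1, abs_le.2 ⟨by linarith, by linarith⟩, by rw [neg_sq]; exact h4⟩
  · rintro ⟨h1, h2, h3⟩
    rw [abs_le] at h2
    rcases le_total z.re 0 with h | h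
    · exact .inl (mem_leftArc_iff.2 ⟨h1, h2.1, h, h3⟩)
    · refine .inr ⟨-(starRingEnd ℂ) z, mem_leftArc_iff.2 ?_, by simp⟩
      simp only [Complex.neg_re, Complex.conj_re, Complex.neg_im, Complex.conj_im, neg_neg]
      exact ⟨h1, by linarith [h2.2], by linarith, by rw [neg_sq]; exact h3⟩

theorem mem_frontier_closedFundDomain_iff {z : ℂ} : z ∈ frontier closedFundDomain ↔
    z ∈ closedFundDomain ∧ (z.re ^ 2 + z.im ^ 2 = 1 ∨ |z.re| = 1 / 2) := by
  have hcl : IsClosed closedFundDomain := isClosed_closure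
  rw [hcl.frontier_eq, Set.mem_sdiff]
  refine and_congr_right fun hz => ?_
  obtain ⟨him, hre, hn⟩ := mem_closedFundDomain_iff.1 hz
  constructor
  · intro hint
    by_contra! hcon
    refine hint (mem_interior.2 ⟨{z : ℂ | 0 < z.im ∧ |z.re| < 1 / 2 ∧ 1 < z.re ^ 2 + z.im ^ 2},
      ?_, ?_, ⟨him, hre.lt_of_ne hcon.2, hn.lt_of_ne' hcon.1⟩⟩)
    · rintro w ⟨h1, h2, h3⟩
      exact mem_closedFundDomain_iff.2 ⟨h1, h2.le, h3.le⟩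
    · refine IsOpen.and ?_ (IsOpen.and ?_ ?_)
      · exact isOpen_lt continuous_const Complex.continuous_im
      · exact isOpen_lt Complex.continuous_re.abs continuous_const
      · exact isOpen_lt continuous_const
          ((Complex.continuous_re.pow 2).add (Complex.continuous_im.pow 2))
  · intro hbd hint
    rw [mem_interior_iff_mem_nhds] at hint
    -- Two choices leave the domain: scaling z by 1 - t crosses the unit circle, and stretching only
    -- the real part by 1 + t crosses a vertical line.
    have hlim : ∀ a b : ℝ, Tendsto (fun t : ℝ => (⟨z.re * (1 + a * t), z.im * (1 + b * t)⟩ : ℂ))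
        (𝓝[>] 0) (𝓝 z) := by
      intro a b
      have h1 : Continuous fun t : ℝ =>
          ((z.re * (1 + a * t) : ℝ) : ℂ) + (z.im * (1 + b * t) : ℝ) * Complex.I := by
        fun_prop
      have h2 := (h1.tendsto 0).mono_left (nhdsWithin_le_nhds (s := Set.Ioi 0))
      simp only [← Complex.mk_eq_add_mul_I, mul_zero, mul_one, add_zero] at h2
      exact h2
    rcases hbd with h | h
    · obtain ⟨t, ht, h0, h1⟩ := (((hlim (-1) (-1)).eventually hint).and
        (Ioo_mem_nhdsGT (one_pos : (0 : ℝ) < 1))).exists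
      have h2 := (mem_closedFundDomain_iff.1 ht).2.2
      simp only at h2
      have h3 : (z.re * (1 + -1 * t)) ^ 2 + (z.im * (1 + -1 * t)) ^ 2 =
        (z.re ^ 2 + z.im ^ 2) * (1 - t) ^ 2 := by ring
      rw [h3, h] at h2
      nlinarith
    · obtain ⟨t, ht, h0, h1⟩ := (((hlim 1 0).eventually hint).and
        (Ioo_mem_nhdsGT (one_pos : (0 : ℝ) < 1))).exists
      have h2 := (mem_closedFundDomain_iff.1 ht).2.1
      simp only at h2
      rw [abs_mul, h, abs_of_pos (by linarith)] at h2
      linarith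

/-! ### From Eisenstein series to cosine sums -/

/-- The coefficient `cos (2 π (a n - b m))` of the lattice point `(m, n)`. -/
noncomputable def latticeCoeff (a b : ℝ) (p : ℤ × ℤ) : ℝ :=
  Real.cos (2 * Real.pi * (a * p.2 - b * p.1))

theorem abs_latticeCoeff_le (a b : ℝ) (p : ℤ × ℤ) : |latticeCoeff a b p| ≤ 1 :=
  Real.abs_cos_le_one _

theorem latticeCoeff_neg (a b : ℝ) (p : ℤ × ℤ) : latticeCoeff a b (-p) = latticeCoeff a b p := by
  rw [latticeCoeff, latticeCoeff, ← Real.cos_neg]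
  congr 1
  simp only [Prod.fst_neg, Prod.snd_neg]
  push_cast
  ring

/-- The sine part of the exponential is odd under p ↦ -p while the even power is invariant, so it
sums to zero. -/
theorem eisSeries_eq_latticeSum (a b : ℝ) {l : ℕ} (hl : 2 ≤ l) {z : ℂ} (hz : 0 < z.im) :
    eisSeries (2 * l) a b z = latticeSum l (latticeCoeff a b) z := by
  set s : ℤ × ℤ → ℝ := fun p => Real.sin (2 * Real.pi * (a * p.2 - b * p.1)) with hs
  have hsn : ∀ p, s (-p) = -s p := by
    intro p
    simp only [hs]
    rw [← Real.sin_neg]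
    congr 1
    simp only [Prod.fst_neg, Prod.snd_neg]
    push_cast
    ring
  have hsum : latticeSum l s z = 0 := by
    have h1 : latticeSum l s z = -latticeSum l s z := by
      conv_lhs => rw [latticeSum, ← (Equiv.neg (ℤ × ℤ)).tsum_eq]
      rw [latticeSum, ← tsum_neg]
      refine tsum_congr fun p => ?_
      rw [Equiv.neg_apply, hsn, linForm_neg, (even_two_mul l).neg_pow]
      push_cast
      ring
    exact self_eq_neg.1 h1
  have hsplit : ∀ p : ℤ × ℤ,
      Complex.exp (2 * Real.pi * Complex.I * (a * (p.2 : ℂ) - b * (p.1 : ℂ))) /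
        ((p.1 : ℂ) * z + (p.2 : ℂ)) ^ (2 * l) =
      (latticeCoeff a b p : ℂ) / linForm p z ^ (2 * l) +
        Complex.I * ((s p : ℂ) / linForm p z ^ (2 * l)) := by
    intro p
    have h1 : (2 * Real.pi * Complex.I * (a * (p.2 : ℂ) - b * (p.1 : ℂ)) : ℂ) =
        ((2 * Real.pi * (a * p.2 - b * p.1) : ℝ) : ℂ) * Complex.I := by
      push_cast; ring
    rw [h1, Complex.exp_mul_I, ← Complex.ofReal_cos, ← Complex.ofReal_sin, linForm]
    simp only [latticeCoeff, hs]
    ring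
  have hfull : eisSeries (2 * l) a b z = ∑' p : ℤ × ℤ,
      Complex.exp (2 * Real.pi * Complex.I * (a * (p.2 : ℂ) - b * (p.1 : ℂ))) /
        ((p.1 : ℂ) * z + (p.2 : ℂ)) ^ (2 * l) := by
    rw [eisSeries]
    refine tsum_subtype_eq_of_support_subset (s := {p : ℤ × ℤ | p ≠ (0, 0)}) (f := fun p : ℤ × ℤ =>
      Complex.exp (2 * Real.pi * Complex.I * (a * (p.2 : ℂ) - b * (p.1 : ℂ))) /
        ((p.1 : ℂ) * z + (p.2 : ℂ)) ^ (2 * l)) ?_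
    rintro p hp rfl
    apply hp
    simp [show l ≠ 0 by omega]
  rw [hfull, tsum_congr hsplit, (summable_latticeSum (abs_latticeCoeff_le a b) hl hz).tsum_add
    ((summable_latticeSum (fun p => Real.abs_sin_le_one _) hl hz).mul_left Complex.I),
    tsum_mul_left]
  change _ + Complex.I * latticeSum l s z = _
  rw [hsum, mul_zero, add_zero, latticeSum]

/-- If Γ(M) ≤ Γ(N), the translation by M lies in Γ(N), which forces N ∣ M. -/
theorem level_Gamma {N : ℕ} (hN : 0 < N) : level (CongruenceSubgroup.Gamma N) = N := by
  refine le_antisymm (Nat.sInf_le ⟨hN, le_rfl⟩) (le_csInf ⟨N, hN, le_rfl⟩ ?_)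
  rintro M ⟨hM, hle⟩
  have h1 : ModularGroup.T ^ (M : ℤ) ∈ CongruenceSubgroup.Gamma M := by
    simpa using CongruenceSubgroup.ModularGroup_T_pow_mem_Gamma (M : ℤ) M dvd_rfl
  have h2 := (CongruenceSubgroup.Gamma_mem.1 (hle h1)).2.1
  rw [ModularGroup.coe_T_zpow] at h2
  simp only [Matrix.of_apply, Matrix.cons_val_zero, Matrix.cons_val_one,
    Matrix.cons_val', Int.cast_natCast] at h2
  exact Nat.le_of_dvd hM ((ZMod.natCast_eq_zero_iff M N).1 (by simpa using h2))

theorem traceForm_conj_Gamma (N k : ℕ) (γ : SL(2, ℤ)) (v : Fin 2 → ZMod N) (z : ℂ) :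
    traceForm N k (conjSubgroup γ (CongruenceSubgroup.Gamma N)) v z = eisIndex N k v z := by
  have h1 : reduction N (conjSubgroup γ (CongruenceSubgroup.Gamma N)) = ⊥ := by
    rw [eq_bot_iff]
    rintro _ ⟨_, ⟨g, hg, rfl⟩, rfl⟩
    have hg' : Matrix.SpecialLinearGroup.map (Int.castRingHom (ZMod N)) g = 1 :=
      CongruenceSubgroup.Gamma_mem'.1 hg
    rw [Subgroup.mem_bot]
    rw [MulEquiv.coe_toMonoidHom, MulAut.conj_apply, map_mul, map_mul, hg', mul_one, ← map_mul,
      mul_inv_cancel, map_one]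
  rw [traceForm, h1, finsum_unique]
  congr 1
  exact Matrix.vecMul_one v

theorem mem_zeroSet_Gamma_iff {N : ℕ} (hN : 0 < N) {l : ℕ} (hl : 2 ≤ l) {z : ℂ} :
    z ∈ zeroSet (2 * l) (CongruenceSubgroup.Gamma N) ↔ z ∈ closedFundDomain ∧
      ∃ v : Fin 2 → ZMod N,
        latticeSum l (latticeCoeff ((v 0).val / N) ((v 1).val / N)) z = 0 := by
  rw [zeroSet, level_Gamma hN, zerosOfLevel]
  refine and_congr_right fun hz => ?_
  have him := (mem_closedFundDomain_iff.1 hz).1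
  simp only [traceForm_conj_Gamma, eisIndex, exists_const]
  refine exists_congr fun v => ?_
  rw [eisSeries_eq_latticeSum _ _ hl him]

/-! ### Dominant terms and zero-free neighbourhoods -/

/-- The form `q` has a nonzero coefficient and, at `z`, strictly smaller absolute value than all
other forms with nonzero coefficient, apart from `-q`. -/
def IsDominant (c : ℤ × ℤ → ℝ) (z : ℂ) (q : ℤ × ℤ) : Prop :=
  q ≠ 0 ∧ c q ≠ 0 ∧ ∀ p ∉ ({q, -q} : Finset (ℤ × ℤ)), p ≠ 0 → c p ≠ 0 →
    ‖linForm q z‖ < ‖linForm p z‖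

theorem IsDominant.exists_ball_ne_zero {c : ℤ × ℤ → ℝ} (hc : ∀ p, |c p| ≤ 1)
    (hcn : ∀ p, c (-p) = c p) {z₀ : ℂ} (hz₀ : 0 < z₀.im) {q : ℤ × ℤ} (hq : IsDominant c z₀ q) :
    ∃ r > 0, ∀ᶠ l : ℕ in atTop, ∀ z ∈ Metric.ball z₀ r, latticeSum l c z ≠ 0 := by
  obtain ⟨r, hr, him, h⟩ := exists_ball_eventually_norm_latticeSum_sub_le hc hz₀ hq.2.2
  exact ⟨r, hr, eventually_latticeSum_ne_zero hcn hq.1 hq.2.1 him h⟩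

theorem tendsto_add_two_atTop : Tendsto (fun j : ℕ => j + 2) atTop atTop :=
  tendsto_add_atTop_nat 2

/-- The zero sets eventually leave a neighbourhood of each point at which all series have a
dominant term. -/
theorem exists_ball_disjoint_zeroSet {N : ℕ} (hN : 0 < N) {z : ℂ}
    (h : z ∈ closedFundDomain → ∀ v : Fin 2 → ZMod N,
      ∃ q, IsDominant (latticeCoeff ((v 0).val / N) ((v 1).val / N)) z q) :
    ∃ r > 0, ∀ᶠ j in atTop,
      Disjoint (zeroSet (2 * (j + 2)) (CongruenceSubgroup.Gamma N)) (Metric.ball z r) := by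
  have : NeZero N := ⟨hN.ne'⟩
  by_cases hz : z ∈ closedFundDomain
  · have him := (mem_closedFundDomain_iff.1 hz).1
    have h1 : ∀ v : Fin 2 → ZMod N, ∃ r > 0, ∀ᶠ l : ℕ in atTop, ∀ w ∈ Metric.ball z r,
        latticeSum l (latticeCoeff ((v 0).val / N) ((v 1).val / N)) w ≠ 0 := by
      intro v
      obtain ⟨q, hq⟩ := h hz v
      exact hq.exists_ball_ne_zero (abs_latticeCoeff_le _ _) (latticeCoeff_neg _ _) him
    choose r hr hev using h1
    -- There are only finitely many indices modulo N, so the smallest radius serves them all.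
    obtain ⟨v₀, hv₀⟩ := Finite.exists_min r
    refine ⟨r v₀, hr v₀, ?_⟩
    filter_upwards [tendsto_add_two_atTop.eventually (eventually_all.2 hev)] with j hj
    rw [Set.disjoint_left]
    intro w hw hwb
    obtain ⟨-, v, hv⟩ := (mem_zeroSet_Gamma_iff hN (Nat.le_add_left 2 j)).1 hw
    exact hj v w (Metric.ball_subset_ball (hv₀ v) hwb) hv
  · obtain ⟨r, hr, hb⟩ := Metric.isOpen_iff.1 (isClosed_closure (s := fundDomain)).isOpen_compl z hz
    refine ⟨r, hr, Eventually.of_forall fun j => Set.disjoint_left.2 fun w hw hwb => ?_⟩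
    exact hb hwb hw.1

/-! ### Parity of the surviving coefficients when cos 2πa = 0 -/

theorem cos_odd_mul_eq_zero {α : ℝ} (hα : Real.cos α = 0) {n : ℤ} (hn : Odd n) :
    Real.cos (n * α) = 0 := by
  obtain ⟨k, rfl⟩ := Real.cos_eq_zero_iff.1 hα
  obtain ⟨m, rfl⟩ := hn
  refine Real.cos_eq_zero_iff.2 ⟨2 * m * k + m + k, ?_⟩
  push_cast
  ring

theorem sin_even_mul_eq_zero {α : ℝ} (hα : Real.cos α = 0) {n : ℤ} (hn : Even n) :
    Real.sin (n * α) = 0 := by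
  obtain ⟨k, rfl⟩ := Real.cos_eq_zero_iff.1 hα
  obtain ⟨m, rfl⟩ := hn
  rw [← Real.sin_int_mul_pi (m * (2 * k + 1))]
  congr 1
  push_cast
  ring

theorem latticeCoeff_zero_left (a b : ℝ) (n : ℤ) :
    latticeCoeff a b (0, n) = Real.cos (n * (2 * Real.pi * a)) := by
  rw [latticeCoeff]
  congr 1
  push_cast
  ring

theorem latticeCoeff_one_left (a b : ℝ) (n : ℤ) :
    latticeCoeff a b (1, n) = Real.cos (n * (2 * Real.pi * a)) * Real.cos (2 * Real.pi * b) +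
      Real.sin (n * (2 * Real.pi * a)) * Real.sin (2 * Real.pi * b) := by
  rw [latticeCoeff, ← Real.cos_sub]
  congr 1
  push_cast
  ring


theorem even_of_latticeCoeff_zero_left_ne {a b : ℝ} (ha : Real.cos (2 * Real.pi * a) = 0) {n : ℤ}
    (h : latticeCoeff a b (0, n) ≠ 0) : Even n := by
  by_contra hn
  rw [Int.not_even_iff_odd] at hn
  exact h (by rw [latticeCoeff_zero_left, cos_odd_mul_eq_zero ha hn])

theorem latticeCoeff_zero_two_ne {a b : ℝ} (ha : Real.cos (2 * Real.pi * a) = 0) :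
    latticeCoeff a b (0, 2) ≠ 0 := by
  rw [latticeCoeff_zero_left]
  push_cast
  rw [Real.cos_two_mul, ha]
  norm_num

theorem even_of_latticeCoeff_one_left_ne {a b : ℝ} (ha : Real.cos (2 * Real.pi * a) = 0)
    (hb : Real.sin (2 * Real.pi * b) = 0) {n : ℤ} (h : latticeCoeff a b (1, n) ≠ 0) : Even n := by
  by_contra hn
  rw [Int.not_even_iff_odd] at hn
  exact h (by rw [latticeCoeff_one_left, cos_odd_mul_eq_zero ha hn, hb]; ring)

theorem odd_of_latticeCoeff_one_left_ne {a b : ℝ} (ha : Real.cos (2 * Real.pi * a) = 0)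
    (hb : Real.cos (2 * Real.pi * b) = 0) {n : ℤ} (h : latticeCoeff a b (1, n) ≠ 0) : Odd n := by
  by_contra hn
  rw [Int.not_odd_iff_even] at hn
  exact h (by rw [latticeCoeff_one_left, sin_even_mul_eq_zero ha hn, hb]; ring)

theorem latticeCoeff_one_zero (a b : ℝ) : latticeCoeff a b (1, 0) = Real.cos (2 * Real.pi * b) := by
  simp [latticeCoeff_one_left]

theorem cos_ne_zero_of_sin_eq_zero {x : ℝ} (h : Real.sin x = 0) : Real.cos x ≠ 0 := by
  intro h'
  have := Real.sin_sq_add_cos_sq x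
  rw [h, h'] at this
  norm_num at this

theorem latticeCoeff_one_unit_ne {a b : ℝ} (ha : Real.cos (2 * Real.pi * a) = 0)
    (hb : Real.sin (2 * Real.pi * b) ≠ 0) {e : ℤ} (he : e = 1 ∨ e = -1) :
    latticeCoeff a b (1, e) ≠ 0 := by
  have hs : Real.sin (2 * Real.pi * a) ≠ 0 := fun h => cos_ne_zero_of_sin_eq_zero h ha
  rw [latticeCoeff_one_left]
  rcases he with rfl | rfl <;> simp [ha, hs, hb]

/-! ### The dominant form at each point of the domain -/

/-- To check domination by a form of squared absolute value `B` it is enough to consider the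
lattice points with first coordinate `0` or `1`, provided that `B < 4 (Im z) ^ 2`. -/
theorem dominated_of_le_one {c : ℤ × ℤ → ℝ} (hcn : ∀ p, c (-p) = c p) {z : ℂ} {q : ℤ × ℤ}
    {S : Finset (ℤ × ℤ)} (hS : ∀ p, -p ∈ S → p ∈ S) {B : ℝ}
    (hB : (q.1 * z.re + q.2) ^ 2 + (q.1 * z.im) ^ 2 = B)
    (h0 : ∀ n : ℤ, 1 ≤ n → (0, n) ∉ S → c (0, n) ≠ 0 → B < (n : ℝ) ^ 2)
    (h1 : ∀ n : ℤ, (1, n) ∉ S → c (1, n) ≠ 0 → B < (z.re + n) ^ 2 + z.im ^ 2)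
    (h2 : B < 4 * z.im ^ 2) :
    ∀ p ∉ S, p ≠ 0 → c p ≠ 0 → ‖linForm q z‖ < ‖linForm p z‖ := by
  have key : ∀ p : ℤ × ℤ, 0 ≤ p.1 → (p.1 = 0 → 0 ≤ p.2) → p ∉ S → p ≠ 0 → c p ≠ 0 →
      ‖linForm q z‖ < ‖linForm p z‖ := by
    rintro ⟨m, n⟩ hm hn hpS hp0 hcp
    rw [norm_linForm_lt_iff, hB]
    simp only at hm hn ⊢
    obtain rfl | rfl | hm2 : m = 0 ∨ m = 1 ∨ 2 ≤ m := by omega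
    · have hn0 : n ≠ 0 := by rintro rfl; exact hp0 rfl
      have h := h0 n (by have := hn rfl; omega) hpS hcp
      simpa using h
    · simpa using h1 n hpS hcp
    · have h3 : (2 : ℝ) ≤ m := by exact_mod_cast hm2
      have h4 : 4 * z.im ^ 2 ≤ (m * z.im) ^ 2 := by
        rw [mul_pow]
        exact mul_le_mul_of_nonneg_right (by nlinarith) (sq_nonneg _)
      nlinarith [sq_nonneg (m * z.re + n)]
  intro p hpS hp0 hcp
  by_cases hp : 0 ≤ p.1 ∧ (p.1 = 0 → 0 ≤ p.2)
  · exact key p hp.1 hp.2 hpS hp0 hcp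
  · have h := key (-p) (by simp only [Prod.fst_neg]; omega)
      (by simp only [Prod.fst_neg, Prod.snd_neg]; omega) (fun h => hpS (hS p h))
      (neg_ne_zero.2 hp0) (by rwa [hcn])
    rwa [linForm_neg, norm_neg] at h

theorem neg_mem_pair {q : ℤ × ℤ} (p : ℤ × ℤ) (h : -p ∈ ({q, -q} : Finset (ℤ × ℤ))) :
    p ∈ ({q, -q} : Finset (ℤ × ℤ)) := by
  simp only [Finset.mem_insert, Finset.mem_singleton, neg_inj] at h ⊢
  rcases h with h | h
  · exact .inr (neg_eq_iff_eq_neg.1 h)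
  · exact .inl h

theorem neg_mem_two_pairs {q₁ q₂ : ℤ × ℤ} (p : ℤ × ℤ)
    (h : -p ∈ ({q₁, -q₁} ∪ {q₂, -q₂} : Finset (ℤ × ℤ))) :
    p ∈ ({q₁, -q₁} ∪ {q₂, -q₂} : Finset (ℤ × ℤ)) := by
  rw [Finset.mem_union] at h ⊢
  exact h.imp (neg_mem_pair p) (neg_mem_pair p)

theorem three_quarters_le_im_sq {z : ℂ} (hz : z ∈ closedFundDomain) : 3 / 4 ≤ z.im ^ 2 := by
  obtain ⟨-, h1, h2⟩ := mem_closedFundDomain_iff.1 hz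
  rw [abs_le] at h1
  nlinarith

/-- Translating by an integer does not decrease the absolute value in the strip. -/
theorem normSq_le_translate {x y : ℝ} (hx : |x| ≤ 1 / 2) (n : ℤ) :
    x ^ 2 + y ^ 2 ≤ (x + n) ^ 2 + y ^ 2 := by
  have h1 : |(n : ℝ)| ≤ (n : ℝ) ^ 2 := by
    rw [← sq_abs]
    rcases eq_or_ne n 0 with rfl | hn
    · simp
    · have : (1 : ℝ) ≤ |(n : ℝ)| := by exact_mod_cast Int.one_le_abs hn
      nlinarith
  have h2 : |x * n| ≤ 1 / 2 * |(n : ℝ)| := by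
    rw [abs_mul]; gcongr
  have h3 := neg_abs_le (x * n)
  nlinarith

/-- Strictness amounts to 2|x| < |n|, which fails only for |x| = 1/2 and n = ±1. This is why the
vertical lines are harmless if just even translates survive. -/
theorem normSq_lt_translate {x y : ℝ} (hx : |x| ≤ 1 / 2) {n : ℤ} (hn : n ≠ 0)
    (h : |x| < 1 / 2 ∨ Even n) : x ^ 2 + y ^ 2 < (x + n) ^ 2 + y ^ 2 := by
  have h1 : (1 : ℝ) ≤ |(n : ℝ)| := by exact_mod_cast Int.one_le_abs hn
  have h3 := neg_abs_le (x * n)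
  rw [abs_mul] at h3
  have h4 := sq_abs (n : ℝ)
  rcases h with h | ⟨m, rfl⟩
  · nlinarith
  · have hm : m ≠ 0 := by omega
    have h5 : (1 : ℝ) ≤ |(m : ℝ)| := by exact_mod_cast Int.one_le_abs hm
    have h6 : |((m + m : ℤ) : ℝ)| = 2 * |(m : ℝ)| := by
      push_cast
      rw [← two_mul, abs_mul]
      norm_num
    rw [h6] at h1 h3 h4
    nlinarith

theorem isDominant_zero_one {a b : ℝ} (ha : Real.cos (2 * Real.pi * a) ≠ 0) {z : ℂ}
    (hz : z ∈ closedFundDomain) (hn : 1 < z.re ^ 2 + z.im ^ 2) :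
    IsDominant (latticeCoeff a b) z (0, 1) := by
  refine ⟨by simp, by simpa [latticeCoeff_zero_left] using ha, ?_⟩
  have hx := (mem_closedFundDomain_iff.1 hz).2.1
  refine dominated_of_le_one (latticeCoeff_neg a b) neg_mem_pair (B := 1) (by simp) ?_ ?_ ?_
  · intro n hn1 hnS _
    have : n ≠ 1 := by rintro rfl; simp at hnS
    have h2 : (2 : ℝ) ≤ n := by exact_mod_cast (by omega : 2 ≤ n)
    nlinarith
  · exact fun n _ _ => hn.trans_le (normSq_le_translate hx n)
  · linarith [three_quarters_le_im_sq hz]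

theorem four_lt_sq_of_even {n : ℤ} (h1 : 1 ≤ n) (h2 : n ≠ 2) (he : Even n) : (4 : ℝ) < (n : ℝ) ^ 2 := by
  obtain ⟨m, rfl⟩ := he
  have : (4 : ℝ) ≤ ((m + m : ℤ) : ℝ) := by exact_mod_cast (by omega : 4 ≤ m + m)
  nlinarith

theorem four_le_sq_of_even {n : ℤ} (h1 : 1 ≤ n) (he : Even n) : (4 : ℝ) ≤ (n : ℝ) ^ 2 := by
  obtain ⟨m, rfl⟩ := he
  have : (2 : ℝ) ≤ ((m + m : ℤ) : ℝ) := by exact_mod_cast (by omega : 2 ≤ m + m)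
  nlinarith

theorem isDominant_zero_two {a b : ℝ} (ha : Real.cos (2 * Real.pi * a) = 0) {z : ℂ}
    (h1 : ∀ n : ℤ, latticeCoeff a b (1, n) ≠ 0 → 4 < (z.re + n) ^ 2 + z.im ^ 2)
    (h2 : 1 < z.im ^ 2) : IsDominant (latticeCoeff a b) z (0, 2) := by
  refine ⟨by simp, latticeCoeff_zero_two_ne ha, ?_⟩
  refine dominated_of_le_one (latticeCoeff_neg a b) neg_mem_pair (B := 4) (by norm_num) ?_ ?_ ?_
  · intro n hn hnS hcn
    exact four_lt_sq_of_even hn (by rintro rfl; simp at hnS)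
      (even_of_latticeCoeff_zero_left_ne ha hcn)
  · exact fun n _ hcn => h1 n hcn
  · linarith

theorem isDominant_one_zero {a b : ℝ} (ha : Real.cos (2 * Real.pi * a) = 0)
    (hb : Real.cos (2 * Real.pi * b) ≠ 0) {z : ℂ} (hz : z ∈ closedFundDomain)
    (hlt : z.re ^ 2 + z.im ^ 2 < 4)
    (h1 : ∀ n : ℤ, latticeCoeff a b (1, n) ≠ 0 → |z.re| < 1 / 2 ∨ Even n) :
    IsDominant (latticeCoeff a b) z (1, 0) := by
  refine ⟨by simp, by rwa [latticeCoeff_one_zero], ?_⟩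
  have hx := (mem_closedFundDomain_iff.1 hz).2.1
  refine dominated_of_le_one (latticeCoeff_neg a b) neg_mem_pair (B := z.re ^ 2 + z.im ^ 2)
    (by simp) ?_ ?_ ?_
  · exact fun n hn _ hcn => hlt.trans_le
      (four_le_sq_of_even hn (even_of_latticeCoeff_zero_left_ne ha hcn))
  · intro n hnS hcn
    exact normSq_lt_translate hx (by rintro rfl; simp at hnS) (h1 n hcn)
  · have := three_quarters_le_im_sq hz
    nlinarith [abs_le.1 hx]

/-- A dominant term exists when `cos (2 π b) ≠ 0`, off the circle `|z| = 2` and, in case some odd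
translates occur below this circle, off the vertical boundary lines. -/
theorem exists_isDominant_of_cos_ne_zero {a b : ℝ} (ha : Real.cos (2 * Real.pi * a) = 0)
    (hb : Real.cos (2 * Real.pi * b) ≠ 0) {z : ℂ} (hz : z ∈ closedFundDomain)
    (hne : z.re ^ 2 + z.im ^ 2 ≠ 4)
    (h1 : z.re ^ 2 + z.im ^ 2 < 4 → Real.sin (2 * Real.pi * b) ≠ 0 → |z.re| < 1 / 2) :
    ∃ q, IsDominant (latticeCoeff a b) z q := by
  have hx := (mem_closedFundDomain_iff.1 hz).2.1
  rcases hne.lt_or_gt with h | h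
  · refine ⟨(1, 0), isDominant_one_zero ha hb hz h fun n hcn => ?_⟩
    by_cases hs : Real.sin (2 * Real.pi * b) = 0
    · exact .inr (even_of_latticeCoeff_one_left_ne ha hs hcn)
    · exact .inl (h1 h hs)
  · refine ⟨(0, 2), isDominant_zero_two ha (fun n _ => h.trans_le (normSq_le_translate hx n)) ?_⟩
    nlinarith [abs_le.1 hx]

/-- The unit e of sign opposite to x gives |x + e| < 1, and every other odd translate has absolute
value greater than 1. -/
theorem sq_add_lt_of_odd {x : ℝ} {e : ℤ} (he : e = 1 ∨ e = -1) (hx : |x| ≤ 1 / 2)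
    (hex : e * x < 0) {n : ℤ} (hn : Odd n) (hne : n ≠ e) : (x + e) ^ 2 < (x + n) ^ 2 := by
  obtain ⟨m, rfl⟩ := hn
  rw [abs_le] at hx
  rcases he with rfl | rfl
  · push_cast at hex ⊢
    rcases lt_or_gt_of_ne (show m ≠ 0 by omega) with h | h
    · have : (m : ℝ) ≤ -1 := by exact_mod_cast (by omega : m ≤ -1)
      nlinarith
    · have : (1 : ℝ) ≤ m := by exact_mod_cast (by omega : 1 ≤ m)
      nlinarith
  · push_cast at hex ⊢
    rcases lt_or_gt_of_ne (show m ≠ -1 by omega) with h | h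
    · have : (m : ℝ) ≤ -2 := by exact_mod_cast (by omega : m ≤ -2)
      nlinarith
    · have : (0 : ℝ) ≤ m := by exact_mod_cast (by omega : 0 ≤ m)
      nlinarith

theorem sq_add_le_of_odd {x : ℝ} {e : ℤ} (he : e = 1 ∨ e = -1) (hx : |x| ≤ 1 / 2)
    (hex : e * x ≤ 0) {n : ℤ} (hn : Odd n) : (x + e) ^ 2 ≤ (x + n) ^ 2 := by
  rcases hex.lt_or_eq with h | h
  · rcases eq_or_ne n e with rfl | hne
    · exact le_rfl
    · exact (sq_add_lt_of_odd he hx h hn hne).le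
  · have hx0 : x = 0 := by
      rcases he with rfl | rfl <;> simpa using h
    have hn1 : (1 : ℝ) ≤ |(n : ℝ)| := by
      exact_mod_cast Int.one_le_abs (by rintro rfl; simp at hn)
    have h3 := sq_abs (n : ℝ)
    have h4 : (e : ℝ) ^ 2 = 1 := by rcases he with rfl | rfl <;> norm_num
    rw [hx0, zero_add, zero_add, h4]
    nlinarith

theorem isDominant_one_unit {a b : ℝ} (ha : Real.cos (2 * Real.pi * a) = 0)
    (hb : Real.cos (2 * Real.pi * b) = 0) {z : ℂ} (hz : z ∈ closedFundDomain) {e : ℤ}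
    (he : e = 1 ∨ e = -1) (hex : e * z.re < 0) (hlt : (z.re + e) ^ 2 + z.im ^ 2 < 4) :
    IsDominant (latticeCoeff a b) z (1, e) := by
  refine ⟨by simp, latticeCoeff_one_unit_ne ha (fun h => cos_ne_zero_of_sin_eq_zero h hb) he, ?_⟩
  have hx := (mem_closedFundDomain_iff.1 hz).2.1
  refine dominated_of_le_one (latticeCoeff_neg a b) neg_mem_pair
    (B := (z.re + e) ^ 2 + z.im ^ 2) (by simp) ?_ ?_ ?_
  · exact fun n hn _ hcn => hlt.trans_le
      (four_le_sq_of_even hn (even_of_latticeCoeff_zero_left_ne ha hcn))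
  · intro n hnS hcn
    have := sq_add_lt_of_odd he hx hex (odd_of_latticeCoeff_one_left_ne ha hb hcn)
      (by rintro rfl; simp at hnS)
    linarith
  · have h1 := three_quarters_le_im_sq hz
    rw [abs_le] at hx
    rcases he with rfl | rfl <;> push_cast at hex ⊢ <;> nlinarith

/-- A dominant term exists when `cos (2 π b) = 0`, off the side arcs and the imaginary segment. -/
theorem exists_isDominant_of_cos_eq_zero {a b : ℝ} (ha : Real.cos (2 * Real.pi * a) = 0)
    (hb : Real.cos (2 * Real.pi * b) = 0) {z : ℂ} (hz : z ∈ closedFundDomain)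
    (hside : z ∉ sideArcs) (himag : z ∉ imagSegment) :
    ∃ q, IsDominant (latticeCoeff a b) z q := by
  obtain ⟨him, hx, hn⟩ := mem_closedFundDomain_iff.1 hz
  obtain ⟨e, he, hex⟩ : ∃ e : ℤ, (e = 1 ∨ e = -1) ∧ e * z.re ≤ 0 := by
    rcases le_total z.re 0 with h | h
    · exact ⟨1, .inl rfl, by simpa using h⟩
    · exact ⟨-1, .inr rfl, by simpa using h⟩
  have hbig : 4 < (z.re + e) ^ 2 + z.im ^ 2 → ∃ q, IsDominant (latticeCoeff a b) z q := by
    intro h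
    refine ⟨(0, 2), isDominant_zero_two ha (fun n hcn => ?_) ?_⟩
    · have := sq_add_le_of_odd he hx hex (odd_of_latticeCoeff_one_left_ne ha hb hcn)
      linarith
    · rw [abs_le] at hx
      rcases he with rfl | rfl <;> push_cast at h hex <;> nlinarith
  have hs3 : √3 ^ 2 = 3 := Real.sq_sqrt (by norm_num)
  -- The form (1, e) is a least odd translate, so it is compared with (0, 2), of squared size 4.
  -- Below 4 it is dominant unless Re z = 0, where it ties with (1, -e) on the excluded segment.
  rcases lt_trichotomy ((z.re + e) ^ 2 + z.im ^ 2) 4 with h | h | h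
  · rcases hex.lt_or_eq with hlt | heq
    · exact ⟨(1, e), isDominant_one_unit ha hb hz he hlt h⟩
    · exfalso
      have hx0 : z.re = 0 := by rcases he with rfl | rfl <;> simpa using heq
      have h4 : (e : ℝ) ^ 2 = 1 := by rcases he with rfl | rfl <;> norm_num
      rw [hx0, zero_add, h4] at h
      rw [hx0] at hn
      refine himag ⟨z.im, by nlinarith, ?_, ?_⟩
      · exact Real.le_sqrt_of_sq_le (by linarith)
      · apply Complex.ext <;> simp [hx0]
  · exfalso
    refine hside ⟨hz, ?_, ?_⟩
    · rw [norm_eq_iff_sq zero_le_two, norm_eq_iff_sq zero_le_two]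
      simp only [Complex.sub_re, Complex.sub_im, Complex.add_re, Complex.add_im, Complex.one_re,
        Complex.one_im]
      rcases he with rfl | rfl <;> push_cast at h
      · right; linarith
      · left; linarith
    · refine Real.sqrt_le_iff.2 ⟨him.le, ?_⟩
      rw [abs_le] at hx
      rcases he with rfl | rfl <;> push_cast at h hex <;> nlinarith
  · exact hbig h

/-- This confines the zeros to a compact set. High up, forms with m ≠ 0 have size at least 3, so the
first surviving (0, k), with k = 1 or 2, dominates uniformly although the region is unbounded. -/
theorem eventually_latticeSum_ne_zero_of_three_le_im (a b : ℝ) : ∀ᶠ l : ℕ in atTop,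
    ∀ z ∈ {z : ℂ | |z.re| ≤ 1 / 2 ∧ 3 ≤ z.im}, latticeSum l (latticeCoeff a b) z ≠ 0 := by
  have hpos : ∀ z ∈ {z : ℂ | |z.re| ≤ 1 / 2 ∧ 3 ≤ z.im}, 0 < z.im := fun z hz => by linarith [hz.2]
  have h0 : ∀ (n : ℤ) (z : ℂ), ‖linForm (0, n) z‖ = |(n : ℝ)| := by
    intro n z
    simp [linForm]
  have h1 : ∀ p : ℤ × ℤ, p.1 ≠ 0 → ∀ z : ℂ, 3 ≤ z.im → 3 ≤ ‖linForm p z‖ := by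
    intro p hp z hz
    have h2 : (linForm p z).im = p.1 * z.im := by simp [linForm]
    have h3 := Complex.abs_im_le_norm (linForm p z)
    rw [h2, abs_mul, abs_of_pos (by linarith : 0 < z.im)] at h3
    have h4 : (1 : ℝ) ≤ |(p.1 : ℝ)| := by exact_mod_cast Int.one_le_abs hp
    nlinarith
  have main : ∀ k : ℤ, (k = 1 ∨ k = 2) → latticeCoeff a b (0, k) ≠ 0 →
      (k = 2 → latticeCoeff a b (0, 1) = 0) → ∀ᶠ l : ℕ in atTop,
      ∀ z ∈ {z : ℂ | |z.re| ≤ 1 / 2 ∧ 3 ≤ z.im}, latticeSum l (latticeCoeff a b) z ≠ 0 := by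
    intro k hk hck hk2
    have hk0 : ((0, k) : ℤ × ℤ) ≠ 0 := by rcases hk with rfl | rfl <;> simp
    have hkabs : |(k : ℝ)| ≤ 2 := by rcases hk with rfl | rfl <;> norm_num
    refine eventually_latticeSum_ne_zero (latticeCoeff_neg a b) (q := (0, k)) hk0 hck hpos ?_
    intro ε hε
    -- The ratio 3/2 is attained for k = 2, where the next competitor has size 3 because (0, ±1) has
    -- coefficient zero.
    refine eventually_norm_latticeSum_sub_le (abs_latticeCoeff_le a b) (A := 1 / 2) (B := 3)
      (M := 2) (R := 3 / 2) (by norm_num) (by norm_num) (fun z hz => hz.1) (fun z hz => hz.2)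
      (fun z _ => by rw [h0]; exact hkabs) _ ?_ hε
    rintro z hz ⟨m, n⟩ hpS hp0 hcp
    rw [h0]
    rcases eq_or_ne m 0 with rfl | hm
    · rw [h0]
      have hn0 : n ≠ 0 := by rintro rfl; exact hp0 rfl
      have hnk : n ≠ k ∧ n ≠ -k := by
        constructor <;> rintro rfl <;> simp at hpS
      have hk3 : 3 * |k| ≤ 2 * |n| := by
        rcases hk with rfl | rfl
        · rcases abs_cases n with h | h <;> norm_num <;> omega
        · have hn1 : n ≠ 1 ∧ n ≠ -1 := by
            constructor <;> rintro rfl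
            · exact hcp (hk2 rfl)
            · refine hcp ?_
              have := latticeCoeff_neg a b (0, 1)
              rw [hk2 rfl] at this
              simpa using this
          rcases abs_cases n with h | h <;> norm_num <;> omega
      have hk3' : 3 * |(k : ℝ)| ≤ 2 * |(n : ℝ)| := by exact_mod_cast hk3
      linarith
    · linarith [h1 (m, n) hm z hz.2]
  by_cases ha : Real.cos (2 * Real.pi * a) = 0
  · exact main 2 (.inr rfl) (latticeCoeff_zero_two_ne ha)
      fun _ => by simpa [latticeCoeff_zero_left] using ha
  · exact main 1 (.inl rfl) (by simpa [latticeCoeff_zero_left] using ha) (by norm_num)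

theorem exists_compact_eventually_zeroSet_subset {N : ℕ} (hN : 0 < N) : ∃ K : Set ℂ,
    IsCompact K ∧ ∀ᶠ j in atTop, zeroSet (2 * (j + 2)) (CongruenceSubgroup.Gamma N) ⊆ K := by
  have : NeZero N := ⟨hN.ne'⟩
  refine ⟨Metric.closedBall 0 4, isCompact_closedBall 0 4, ?_⟩
  have h1 : ∀ v : Fin 2 → ZMod N, ∀ᶠ l : ℕ in atTop,
      ∀ z ∈ {z : ℂ | |z.re| ≤ 1 / 2 ∧ 3 ≤ z.im},
        latticeSum l (latticeCoeff ((v 0).val / N) ((v 1).val / N)) z ≠ 0 :=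
    fun v => eventually_latticeSum_ne_zero_of_three_le_im _ _
  filter_upwards [tendsto_add_two_atTop.eventually (eventually_all.2 h1)] with j hj z hz
  obtain ⟨hzF, v, hv⟩ := (mem_zeroSet_Gamma_iff hN (Nat.le_add_left 2 j)).1 hz
  obtain ⟨him, hre, -⟩ := mem_closedFundDomain_iff.1 hzF
  rw [mem_closedBall_zero_iff]
  have h3 : z.im < 3 := by
    by_contra! hcon
    exact hj v z ⟨hre, hcon⟩ hv
  have := Complex.norm_le_abs_re_add_abs_im z
  rw [abs_of_pos him] at this
  linarith

/-! ### Accumulation of zeros along the tie curves -/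

/-- The points all of whose neighbourhoods eventually contain zeros. -/
def accumSet (N : ℕ) : Set ℂ :=
  {z | ∀ ε > 0, ∀ᶠ j in atTop,
    (zeroSet (2 * (j + 2)) (CongruenceSubgroup.Gamma N) ∩ Metric.ball z ε).Nonempty}

theorem isClosed_accumSet (N : ℕ) : IsClosed (accumSet N) := by
  refine isClosed_of_closure_subset fun z hz ε hε => ?_
  obtain ⟨w, hw, hzw⟩ := Metric.mem_closure_iff.1 hz (ε / 2) (half_pos hε)
  filter_upwards [hw (ε / 2) (half_pos hε)] with j hj
  refine hj.mono (Set.inter_subset_inter_right _ (Metric.ball_subset_ball' ?_))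
  rw [dist_comm] at hzw
  linarith

/-- Endpoints of the limit curves, where further forms may tie or the boundary is met, follow from
closedness. -/
theorem mem_accumSet_of_Ioo {N : ℕ} {f : ℝ → ℂ} (hf : Continuous f) {a b : ℝ} (hab : a < b)
    (h : ∀ x ∈ Set.Ioo a b, f x ∈ accumSet N) {x : ℝ} (hx : x ∈ Set.Icc a b) :
    f x ∈ accumSet N := by
  rw [← closure_Ioo hab.ne] at hx
  exact closure_minimal h ((isClosed_accumSet N).preimage hf) hx

theorem mem_accumSet_of_eventually {N i j : ℕ} (hi : i < N) (hj : j < N) {z₀ : ℂ} {U : Set ℂ}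
    (hU : IsOpen U) (hz₀ : z₀ ∈ U)
    (h : ∀ ε > 0, ∀ᶠ l : ℕ in atTop, ∃ z ∈ Metric.ball z₀ ε,
      latticeSum l (latticeCoeff (i / N) (j / N)) z = 0 ∧ (z ∈ U → z ∈ closedFundDomain)) :
    z₀ ∈ accumSet N := by
  intro ε hε
  obtain ⟨r, hr, hrU⟩ := Metric.isOpen_iff.1 hU z₀ hz₀
  filter_upwards [tendsto_add_two_atTop.eventually (h (min r ε) (lt_min hr hε))] with k hk
  obtain ⟨z, hz, h0, hzF⟩ := hk
  refine ⟨z, (mem_zeroSet_Gamma_iff (by omega) (Nat.le_add_left 2 k)).2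
    ⟨hzF (hrU (Metric.ball_subset_ball (min_le_left _ _) hz)), ![(i : ZMod N), (j : ZMod N)], ?_⟩,
    Metric.ball_subset_ball (min_le_right _ _) hz⟩
  simpa [ZMod.val_natCast_of_lt hi, ZMod.val_natCast_of_lt hj] using h0

theorem isOpen_strip : IsOpen {z : ℂ | 0 < z.im ∧ |z.re| < 1 / 2} :=
  (isOpen_lt continuous_const Complex.continuous_im).and
    (isOpen_lt Complex.continuous_re.abs continuous_const)

theorem isOpen_strip_inter : IsOpen {z : ℂ | 0 < z.im ∧ |z.re| < 1 / 2 ∧ 1 < z.re ^ 2 + z.im ^ 2} :=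
  (isOpen_lt continuous_const Complex.continuous_im).and
    ((isOpen_lt Complex.continuous_re.abs continuous_const).and (isOpen_lt continuous_const
      ((Complex.continuous_re.pow 2).add (Complex.continuous_im.pow 2))))

/-- Zeros accumulate at interior points of the fundamental domain where two terms with nonzero
coefficients tie. -/
theorem mem_accumSet_of_tie {N i j : ℕ} (hi : i < N) (hj : j < N) {q₁ q₂ : ℤ × ℤ}
    (hdet : q₁.1 * q₂.2 - q₁.2 * q₂.1 ≠ 0) (hc₁ : latticeCoeff (i / N) (j / N) q₁ ≠ 0)
    (hc₂ : latticeCoeff (i / N) (j / N) q₂ ≠ 0) {z₀ : ℂ}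
    (hz₀ : z₀ ∈ {z : ℂ | 0 < z.im ∧ |z.re| < 1 / 2 ∧ 1 < z.re ^ 2 + z.im ^ 2})
    (htie : ‖linForm q₁ z₀‖ = ‖linForm q₂ z₀‖)
    (hS : ∀ p ∉ ({q₁, -q₁} ∪ {q₂, -q₂} : Finset (ℤ × ℤ)), p ≠ 0 →
      latticeCoeff (i / N) (j / N) p ≠ 0 → ‖linForm q₁ z₀‖ < ‖linForm p z₀‖) :
    z₀ ∈ accumSet N := by
  refine mem_accumSet_of_eventually hi hj isOpen_strip_inter hz₀ fun ε hε => ?_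
  filter_upwards [eventually_exists_zero_near_tie (abs_latticeCoeff_le _ _) (latticeCoeff_neg _ _)
    hdet hc₁ hc₂ hz₀.1 htie hS hε] with l ⟨z, hz, h0, _⟩
  exact ⟨z, hz, h0, fun h => mem_closedFundDomain_iff.2 ⟨h.1, h.2.1.le, h.2.2.le⟩⟩

/-- The index (0, 0) gives the level one series, all coefficients being 1. Zeros merely near the arc
could lie below the domain, so they are produced on the arc itself. -/
theorem arcs_subset_accumSet {N : ℕ} (hN : 0 < N) : leftArc ∪ rightArc ⊆ accumSet N := by
  intro z hz
  obtain ⟨him, hre, hn⟩ := mem_arcs_iff.1 hz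
  have hf : Continuous fun x : ℝ => (x : ℂ) + (√(1 - x ^ 2) : ℝ) * Complex.I := by fun_prop
  have hzx : z = (z.re : ℂ) + (√(1 - z.re ^ 2) : ℝ) * Complex.I := by
    rw [show 1 - z.re ^ 2 = z.im ^ 2 by linarith, Real.sqrt_sq him.le, Complex.re_add_im]
  rw [hzx]
  refine mem_accumSet_of_Ioo hf (a := -(1 / 2)) (b := 1 / 2) (by norm_num) ?_ (abs_le.1 hre)
  clear hzx him hre hn hz z
  intro x hx
  have hx2 : x ^ 2 < 1 / 4 := by nlinarith [hx.1, hx.2]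
  set w : ℂ := (x : ℂ) + (√(1 - x ^ 2) : ℝ) * Complex.I with hw
  have hwre : w.re = x := by simp [hw]
  have hwim : w.im = √(1 - x ^ 2) := by simp [hw]
  have hwim2 : w.im ^ 2 = 1 - x ^ 2 := by rw [hwim, Real.sq_sqrt (by linarith)]
  have hwpos : 0 < w.im := by rw [hwim]; exact Real.sqrt_pos.2 (by linarith)
  have hxa : |x| < 1 / 2 := abs_lt.2 hx
  refine mem_accumSet_of_eventually hN hN isOpen_strip ⟨hwpos, by rwa [hwre]⟩ fun ε hε => ?_
  have hcoef : ∀ p, latticeCoeff ((0 : ℕ) / N) ((0 : ℕ) / N) p = 1 := by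
    intro p; simp [latticeCoeff]
  have h1 : ∀ z : ℂ, ‖linForm (0, 1) z‖ = ‖linForm (1, 0) z‖ ↔ z.re ^ 2 + z.im ^ 2 = 1 := by
    intro z
    rw [norm_linForm_eq_iff]
    simp only [Int.cast_zero, Int.cast_one, zero_mul, one_mul, zero_add, add_zero]
    constructor <;> intro h <;> linarith
  have h2 := eventually_exists_zero_on_tie (abs_latticeCoeff_le ((0 : ℕ) / N) ((0 : ℕ) / N))
    (latticeCoeff_neg _ _) (q₁ := (0, 1)) (q₂ := (1, 0)) (by norm_num) (by rw [hcoef]; norm_num)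
    (by rw [hcoef, hcoef]) (Equiv.prodComm ℤ ℤ) (fun p => by rw [hcoef, hcoef]) (fun z hz htie => ?_)
    (fun z => by simp [linForm]) hwpos ((h1 w).2 (by rw [hwre]; linarith))
    (dominated_of_le_one (latticeCoeff_neg _ _) neg_mem_two_pairs (B := 1) (by simp) ?_ ?_ ?_) hε
  · filter_upwards [h2] with l ⟨z, hz, h0, htie⟩
    refine ⟨z, hz, h0, fun hzU => mem_closedFundDomain_iff.2 ⟨hzU.1, hzU.2.le, ?_⟩⟩
    exact ((h1 z).1 htie).ge
  -- On |z| = 1 conjugation is inversion, so it sends mz + n to z⁻¹(nz + m) and swaps the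
  -- coordinates.
  · refine ⟨z⁻¹, fun p => ?_⟩
    have hz0 : z ≠ 0 := by rintro rfl; simp at hz
    have hconj : (starRingEnd ℂ) z = z⁻¹ := by
      rw [Complex.inv_def, Complex.normSq_apply, ← sq, ← sq, (h1 z).1 htie]
      simp
    simp only [linForm, map_add, map_mul, map_intCast, hconj, Equiv.prodComm_apply, Prod.fst_swap,
      Prod.snd_swap]
    field_simp
    ring
  · intro n hn hnS _
    have : n ≠ 1 := by rintro rfl; simp at hnS
    have h2 : (2 : ℝ) ≤ n := by exact_mod_cast (by omega : 2 ≤ n)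
    nlinarith
  · intro n hnS _
    rw [hwre]
    have := normSq_lt_translate (y := w.im) hxa.le (n := n) (by rintro rfl; simp at hnS) (.inl hxa)
    linarith
  · linarith

theorem natCast_div_four_mul {M : ℕ} (hM : 0 < M) : ((M : ℕ) : ℝ) / ((4 * M : ℕ) : ℝ) = 1 / 4 := by
  have : (M : ℝ) ≠ 0 := by exact_mod_cast hM.ne'
  push_cast
  field_simp

theorem cos_two_pi_mul_quarter : Real.cos (2 * Real.pi * (1 / 4)) = 0 := by
  rw [show 2 * Real.pi * (1 / 4) = Real.pi / 2 by ring, Real.cos_pi_div_two]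

/-- The index (1/4, 0) removes (0, ±1) and keeps (1, 0) and (0, 2), which tie on |z| = 2. -/
theorem middleArc_subset_accumSet {M : ℕ} (hM : 0 < M) : middleArc ⊆ accumSet (4 * M) := by
  rintro z ⟨hzF, hn⟩
  rw [norm_eq_iff_sq zero_le_two] at hn
  obtain ⟨him, hre, -⟩ := mem_closedFundDomain_iff.1 hzF
  have hf : Continuous fun x : ℝ => (x : ℂ) + (√(4 - x ^ 2) : ℝ) * Complex.I := by fun_prop
  have hzx : z = (z.re : ℂ) + (√(4 - z.re ^ 2) : ℝ) * Complex.I := by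
    rw [show 4 - z.re ^ 2 = z.im ^ 2 by linarith, Real.sqrt_sq him.le, Complex.re_add_im]
  rw [hzx]
  refine mem_accumSet_of_Ioo hf (a := -(1 / 2)) (b := 1 / 2) (by norm_num) ?_ (abs_le.1 hre)
  clear hzx him hre hn hzF z
  intro x hx
  have hx2 : x ^ 2 < 1 / 4 := by nlinarith [hx.1, hx.2]
  set w : ℂ := (x : ℂ) + (√(4 - x ^ 2) : ℝ) * Complex.I with hw
  have hwre : w.re = x := by simp [hw]
  have hwim : w.im = √(4 - x ^ 2) := by simp [hw]
  have hwim2 : w.im ^ 2 = 4 - x ^ 2 := by rw [hwim, Real.sq_sqrt (by linarith)]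
  have hwpos : 0 < w.im := by rw [hwim]; exact Real.sqrt_pos.2 (by linarith)
  have hxa : |x| < 1 / 2 := abs_lt.2 hx
  have ha := cos_two_pi_mul_quarter
  have hb : Real.sin (2 * Real.pi * 0) = 0 := by simp
  have h0 : ((0 : ℕ) : ℝ) / ((4 * M : ℕ) : ℝ) = 0 := by simp
  refine mem_accumSet_of_tie (i := M) (j := 0) (q₁ := (1, 0)) (q₂ := (0, 2)) (by omega) (by omega)
    (by norm_num) ?_ ?_ ⟨hwpos, by rwa [hwre], by rw [hwre]; linarith⟩ ?_ ?_
  · rw [natCast_div_four_mul hM, h0, latticeCoeff_one_zero]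
    exact cos_ne_zero_of_sin_eq_zero hb
  · rw [natCast_div_four_mul hM]
    exact latticeCoeff_zero_two_ne ha
  · rw [norm_linForm_eq_iff, hwre]
    push_cast
    linarith
  · rw [natCast_div_four_mul hM, h0]
    refine dominated_of_le_one (latticeCoeff_neg _ _) neg_mem_two_pairs (B := 4) ?_ ?_ ?_ ?_
    · rw [hwre]; push_cast; linarith
    · intro n hn hnS hcn
      exact four_lt_sq_of_even hn (by rintro rfl; simp at hnS)
        (even_of_latticeCoeff_zero_left_ne ha hcn)
    · intro n hnS _
      rw [hwre]
      have := normSq_lt_translate (y := w.im) hxa.le (n := n) (by rintro rfl; simp at hnS)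
        (.inl hxa)
      linarith
    · linarith

/-- The index (1/4, 1/4) keeps only odd n among the forms (1, n); the nearest of them, (1, e), ties
with (0, 2) on |z + e| = 2. -/
theorem sideArcs_subset_accumSet {M : ℕ} (hM : 0 < M) : sideArcs ⊆ accumSet (4 * M) := by
  rintro z ⟨hzF, hside, hsqrt⟩
  obtain ⟨him, hre, -⟩ := mem_closedFundDomain_iff.1 hzF
  obtain ⟨e, he, hn⟩ : ∃ e : ℤ, (e = 1 ∨ e = -1) ∧ (z.re + e) ^ 2 + z.im ^ 2 = 4 := by
    rw [norm_eq_iff_sq zero_le_two, norm_eq_iff_sq zero_le_two] at hside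
    simp only [Complex.sub_re, Complex.sub_im, Complex.add_re, Complex.add_im, Complex.one_re,
      Complex.one_im] at hside
    rcases hside with h | h
    · exact ⟨-1, .inr rfl, by push_cast; linarith⟩
    · exact ⟨1, .inl rfl, by push_cast; linarith⟩
  have he2 : (e : ℝ) * e = 1 := by rcases he with rfl | rfl <;> norm_num
  have hf : Continuous fun t : ℝ => (-(e * t : ℝ) : ℂ) + (√(4 - (1 - t) ^ 2) : ℝ) * Complex.I := by
    fun_prop
  set t := -(e * z.re) with ht
  have htre : -(e * t) = z.re := by rw [ht]; linear_combination z.re * he2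
  have hzx : z = (-(e * t : ℝ) : ℂ) + (√(4 - (1 - t) ^ 2) : ℝ) * Complex.I := by
    have h1 : 4 - (1 - t) ^ 2 = z.im ^ 2 := by
      rw [ht]; linear_combination -hn + (z.re ^ 2 - 1) * he2 * (-1)
    rw [h1, Real.sqrt_sq him.le, ← Complex.ofReal_neg, htre, Complex.re_add_im]
  -- The bound Im z ≥ √3 selects the half of each circle on which (1, e) is the nearer odd
  -- translate, that is, t ≥ 0.
  have ht12 : t ∈ Set.Icc (0 : ℝ) (1 / 2) := by
    have h3 : 3 ≤ z.im ^ 2 := by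
      have := Real.sqrt_le_iff.1 hsqrt
      exact this.2
    rw [abs_le] at hre
    rw [ht]
    rcases he with rfl | rfl <;> push_cast at hn ⊢ <;> constructor <;> nlinarith
  rw [hzx]
  refine mem_accumSet_of_Ioo hf (a := 0) (b := 1 / 2) (by norm_num) ?_ ht12
  clear hzx htre ht12 him hre hn hzF hside hsqrt
  clear_value t
  clear ht t z
  intro t ht
  set w : ℂ := (-(e * t : ℝ) : ℂ) + (√(4 - (1 - t) ^ 2) : ℝ) * Complex.I with hw
  have hwre : w.re = -(e * t) := by simp [hw]
  have hwim : w.im = √(4 - (1 - t) ^ 2) := by simp [hw]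
  have ht1 : (1 - t) ^ 2 < 1 := by nlinarith [ht.1, ht.2]
  have hwim2 : w.im ^ 2 = 4 - (1 - t) ^ 2 := by rw [hwim, Real.sq_sqrt (by linarith)]
  have hwpos : 0 < w.im := by rw [hwim]; exact Real.sqrt_pos.2 (by linarith)
  have hre2 : w.re ^ 2 = t ^ 2 := by rw [hwre]; linear_combination t ^ 2 * he2
  have hxa : |w.re| < 1 / 2 := by
    rw [hwre]
    rcases he with rfl | rfl <;> rw [abs_lt] <;> push_cast <;> constructor <;> linarith [ht.1, ht.2]
  have hB : (w.re + e) ^ 2 + w.im ^ 2 = 4 := by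
    rw [hwim2, hwre]; linear_combination (1 - t) ^ 2 * he2
  have hex : e * w.re < 0 := by
    rw [hwre]
    have : (e : ℝ) * -(e * t) = -t := by linear_combination -t * he2
    linarith [ht.1]
  have ha := cos_two_pi_mul_quarter
  refine mem_accumSet_of_tie (i := M) (j := M) (q₁ := (1, e)) (q₂ := (0, 2)) (by omega) (by omega)
    (by norm_num) ?_ ?_ ⟨hwpos, hxa, by nlinarith [ht.2]⟩ ?_ ?_
  · rw [natCast_div_four_mul hM]
    exact latticeCoeff_one_unit_ne ha (fun h => cos_ne_zero_of_sin_eq_zero h ha) he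
  · rw [natCast_div_four_mul hM]
    exact latticeCoeff_zero_two_ne ha
  · rw [norm_linForm_eq_iff]
    push_cast
    linarith
  · rw [natCast_div_four_mul hM]
    refine dominated_of_le_one (latticeCoeff_neg _ _) neg_mem_two_pairs (B := 4) ?_ ?_ ?_ ?_
    · push_cast; linarith
    · intro n hn hnS hcn
      exact four_lt_sq_of_even hn (by rintro rfl; simp at hnS)
        (even_of_latticeCoeff_zero_left_ne ha hcn)
    · intro n hnS hcn
      have := sq_add_lt_of_odd he hxa.le hex (odd_of_latticeCoeff_one_left_ne ha ha hcn)
        (by rintro rfl; simp at hnS)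
      linarith
    · linarith

theorem imagSegment_subset_accumSet {M : ℕ} (hM : 0 < M) : imagSegment ⊆ accumSet (4 * M) := by
  rintro _ ⟨y, hy1, hy2, rfl⟩
  have hf : Continuous fun y : ℝ => (y : ℂ) * Complex.I := by fun_prop
  have hs3 : √3 ^ 2 = 3 := Real.sq_sqrt (by norm_num)
  refine mem_accumSet_of_Ioo hf (a := 1) (b := √3) (Real.lt_sqrt_of_sq_lt (by norm_num)) ?_
    ⟨hy1, hy2⟩
  clear hy1 hy2 y
  intro y hy
  have hy3 : y ^ 2 < 3 := by nlinarith [hy.1, hy.2]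
  have hy1 : 1 < y := hy.1
  have hwre : ((y : ℂ) * Complex.I).re = 0 := by simp
  have hwim : ((y : ℂ) * Complex.I).im = y := by simp
  have ha := cos_two_pi_mul_quarter
  have hs : Real.sin (2 * Real.pi * (1 / 4)) ≠ 0 := fun h => cos_ne_zero_of_sin_eq_zero h ha
  refine mem_accumSet_of_tie (i := M) (j := M) (q₁ := (1, 1)) (q₂ := (1, -1)) (by omega) (by omega)
    (by norm_num) ?_ ?_ ⟨by rw [hwim]; linarith, by rw [hwre]; norm_num, by rw [hwre, hwim]; nlinarith⟩
    ?_ ?_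
  · rw [natCast_div_four_mul hM]
    exact latticeCoeff_one_unit_ne ha hs (.inl rfl)
  · rw [natCast_div_four_mul hM]
    exact latticeCoeff_one_unit_ne ha hs (.inr rfl)
  · rw [norm_linForm_eq_iff]
    simp
  · rw [natCast_div_four_mul hM]
    refine dominated_of_le_one (latticeCoeff_neg _ _) neg_mem_two_pairs (B := 1 + y ^ 2) ?_ ?_ ?_ ?_
    · simp
    · intro n hn hnS hcn
      have := four_le_sq_of_even hn (even_of_latticeCoeff_zero_left_ne ha hcn)
      linarith
    · intro n hnS hcn
      obtain ⟨m, rfl⟩ := odd_of_latticeCoeff_one_left_ne ha ha hcn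
      have h1 : m ≠ 0 := by rintro rfl; simp at hnS
      have h2 : m ≠ -1 := by rintro rfl; simp at hnS
      -- For n = 2m + 1 one has n² = 1 + 4m(m + 1), so this says that n² > 1.
      have h3 : 0 < m * (m + 1) := by
        rcases lt_or_gt_of_ne h1 with h | h
        · have : m + 1 < 0 := by omega
          nlinarith
        · nlinarith
      have h4 : (0 : ℝ) < m * (m + 1) := by exact_mod_cast h3
      rw [hwre, hwim]
      push_cast
      nlinarith
    · rw [hwim]
      nlinarith

/-! ### The vertical boundary lines -/

/-- On the vertical boundary line `Re z = -e / 2` below `|z| = 2` the forms at `(1, 0)` and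
`(1, e)` tie and dominate all others. -/
theorem dominated_of_vertical {b : ℝ} {e : ℤ} (he : e = 1 ∨ e = -1) {z : ℂ}
    (hre : z.re = -e / 2) (h1 : 3 / 4 < z.im ^ 2) (h2 : z.im ^ 2 < 15 / 4) :
    ∀ p ∉ ({(1, 0), -(1, 0)} ∪ {(1, e), -(1, e)} : Finset (ℤ × ℤ)), p ≠ 0 →
      latticeCoeff (1 / 4) b p ≠ 0 → ‖linForm (1, 0) z‖ < ‖linForm p z‖ := by
  have he2 : (e : ℝ) ^ 2 = 1 := by rcases he with rfl | rfl <;> norm_num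
  refine dominated_of_le_one (latticeCoeff_neg _ _) neg_mem_two_pairs
    (B := 1 / 4 + z.im ^ 2) ?_ ?_ ?_ ?_
  · rw [hre]; push_cast; linear_combination (1 / 4) * he2
  · intro n hn _ hcn
    have := four_le_sq_of_even hn (even_of_latticeCoeff_zero_left_ne cos_two_pi_mul_quarter hcn)
    linarith
  · intro n hnS _
    have hn0 : n ≠ 0 := by rintro rfl; simp at hnS
    have hne : n ≠ e := by rintro rfl; simp at hnS
    have h3 : 0 < n * (n - e) := by
      rcases lt_or_gt_of_ne hn0 with h | h
      · have : n - e < 0 := by omega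
        nlinarith
      · have : 0 < n - e := by omega
        positivity
    have h4 : (0 : ℝ) < n * (n - e) := by exact_mod_cast h3
    have h5 : (z.re + n) ^ 2 = n * (n - e) + 1 / 4 := by
      rw [hre]; linear_combination (1 / 4) * he2
    linarith
  · linarith

theorem vertical_tie_iff {e : ℤ} (he : e = 1 ∨ e = -1) {z : ℂ} :
    ‖linForm (1, 0) z‖ = ‖linForm (1, e) z‖ ↔ z.re = -e / 2 := by
  rw [norm_linForm_eq_iff]
  rcases he with rfl | rfl <;> push_cast <;> constructor <;> intro h <;> nlinarith

/-- This neighbourhood controls the unit circle and the opposite vertical line only; the side of Re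
z = -e/2 is decided by the location of the zero. -/
theorem isOpen_vertical (e : ℝ) :
    IsOpen {z : ℂ | 0 < z.im ∧ e * z.re < 1 / 2 ∧ 1 < z.re ^ 2 + z.im ^ 2} :=
  (isOpen_lt continuous_const Complex.continuous_im).and
    ((isOpen_lt (continuous_const.mul Complex.continuous_re) continuous_const).and
      (isOpen_lt continuous_const
        ((Complex.continuous_re.pow 2).add (Complex.continuous_im.pow 2))))

theorem mem_accumSet_vertical_of_three_le {M : ℕ} (hM : 3 ≤ M) {e : ℤ} (he : e = 1 ∨ e = -1)
    {z : ℂ} (him : 0 < z.im) (hre : z.re = -e / 2) (h1 : 3 / 4 < z.im ^ 2)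
    (h2 : z.im ^ 2 < 15 / 4) : z ∈ accumSet (4 * M) := by
  have hpi := Real.pi_pos
  have hM0 : (3 : ℝ) ≤ M := by exact_mod_cast hM
  have he2 : (e : ℝ) ^ 2 = 1 := by rcases he with rfl | rfl <;> norm_num
  -- With a = 1/4 and b = 1/4 - 1/(4M) the coefficients at (1, 0) and (1, e) have sizes sin δ and
  -- cos δ. For M ≥ 3 one has δ < π/4, so the zeros satisfy |z| < |z + e| and lie inside the strip.
  set δ : ℝ := 2 * Real.pi / (4 * M) with hδ
  have hδ0 : 0 < δ := by positivity
  have hδ1 : δ < Real.pi / 4 := by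
    rw [hδ, div_lt_iff₀ (by linarith)]
    nlinarith
  have hb : 2 * Real.pi * (((M - 1 : ℕ) : ℝ) / ((4 * M : ℕ) : ℝ)) = Real.pi / 2 - δ := by
    rw [hδ, Nat.cast_sub (by omega)]
    push_cast
    field_simp
    ring
  have ha := natCast_div_four_mul (M := M) (by omega)
  have hsin : 0 < Real.sin δ := Real.sin_pos_of_pos_of_lt_pi hδ0 (by linarith)
  have hsc : Real.sin δ < Real.cos δ := by
    rw [← Real.sin_pi_div_two_sub]
    exact Real.sin_lt_sin_of_lt_of_le_pi_div_two (by linarith) (by linarith) (by linarith)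
  have hc1 : latticeCoeff ((M : ℕ) / (4 * M : ℕ)) ((M - 1 : ℕ) / (4 * M : ℕ)) (1, 0) =
      Real.sin δ := by
    rw [latticeCoeff_one_zero, hb, Real.cos_pi_div_two_sub]
  have hc2 : |latticeCoeff ((M : ℕ) / (4 * M : ℕ)) ((M - 1 : ℕ) / (4 * M : ℕ)) (1, e)| =
      Real.cos δ := by
    rw [latticeCoeff_one_left, hb, ha, Real.sin_pi_div_two_sub,
      show 2 * Real.pi * (1 / 4) = Real.pi / 2 by ring]
    have : 0 < Real.cos δ := hsin.trans hsc
    rcases he with rfl | rfl <;> simp [this.le]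
  refine mem_accumSet_of_eventually (i := M) (j := M - 1) (by omega) (by omega)
    (isOpen_vertical e) ⟨him, ?_, ?_⟩ fun ε hε => ?_
  · rw [hre]
    nlinarith
  · rw [hre]
    nlinarith
  have hz := eventually_exists_zero_near_tie (abs_latticeCoeff_le _ _) (latticeCoeff_neg _ _)
    (c := latticeCoeff ((M : ℕ) / (4 * M : ℕ)) ((M - 1 : ℕ) / (4 * M : ℕ)))
    (q₁ := (1, 0)) (q₂ := (1, e)) (by rcases he with rfl | rfl <;> norm_num)
    (by rw [hc1]; exact hsin.ne') (by rw [← abs_pos, hc2]; exact hsin.trans hsc) him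
    ((vertical_tie_iff he).2 hre) (by rw [ha]; exact dominated_of_vertical he hre h1 h2) hε
  filter_upwards [hz] with l ⟨w, hw, h0, hlt⟩
  refine ⟨w, hw, h0, fun hU => mem_closedFundDomain_iff.2 ⟨hU.1, ?_, hU.2.2.le⟩⟩
  have h3 := hlt (by rw [hc1, hc2, abs_of_pos hsin]; exact hsc)
  rw [norm_linForm_lt_iff] at h3
  have h4 := hU.2.1
  rw [abs_le]
  rcases he with rfl | rfl <;> push_cast at h3 h4 <;> constructor <;> nlinarith

/-- The lattice involution given by complex conjugation on the line `Re z = -e / 2`. -/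
def reflectEquiv (e : ℤ) : ℤ × ℤ ≃ ℤ × ℤ where
  toFun p := (-p.1, p.2 - e * p.1)
  invFun p := (-p.1, p.2 - e * p.1)
  left_inv p := by ext <;> simp
  right_inv p := by ext <;> simp

/-- For N = 8 the angle δ would be exactly π/4: the two coefficients have equal size and favour no
side. Reflection in the line then supplies a real structure instead. -/
theorem mem_accumSet_vertical_eight {e : ℤ} (he : e = 1 ∨ e = -1) {z : ℂ} (him : 0 < z.im)
    (hre : z.re = -e / 2) (h1 : 3 / 4 < z.im ^ 2) (h2 : z.im ^ 2 < 15 / 4) :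
    z ∈ accumSet (4 * 2) := by
  have he2 : (e : ℝ) ^ 2 = 1 := by rcases he with rfl | rfl <;> norm_num
  -- The choice b = 1/8 or 3/8, according to e, makes the coefficients at (1, 0) and (1, e) equal
  -- with sign and all coefficients invariant under the reflection.
  obtain ⟨j, hj, hjb⟩ : ∃ j : ℕ, j < 4 * 2 ∧ (j : ℝ) / ((4 * 2 : ℕ) : ℝ) = 1 / 4 - e / 8 := by
    rcases he with rfl | rfl
    · exact ⟨1, by norm_num, by norm_num⟩
    · exact ⟨3, by norm_num, by norm_num⟩
  have ha := natCast_div_four_mul (M := 2) (by norm_num)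
  have hb : 2 * Real.pi * (1 / 4 - e / 8 : ℝ) = Real.pi / 2 - e * (Real.pi / 4) := by ring
  have hs : Real.sin (e * (Real.pi / 4)) = e * Real.cos (Real.pi / 4) := by
    rcases he with rfl | rfl <;> simp
  have hc : Real.cos (e * (Real.pi / 4)) = Real.cos (Real.pi / 4) := by
    rcases he with rfl | rfl <;> simp
  have hcpos : 0 < Real.cos (Real.pi / 4) := by rw [Real.cos_pi_div_four]; positivity
  have hc1 : latticeCoeff (1 / 4) (1 / 4 - e / 8) (1, 0) = e * Real.cos (Real.pi / 4) := by
    rw [latticeCoeff_one_zero, hb, Real.cos_pi_div_two_sub, hs]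
  have hc2 : latticeCoeff (1 / 4) (1 / 4 - e / 8) (1, e) = e * Real.cos (Real.pi / 4) := by
    rw [latticeCoeff_one_left, hb, Real.sin_pi_div_two_sub, hc,
      show 2 * Real.pi * (1 / 4) = Real.pi / 2 by ring]
    rcases he with rfl | rfl <;> simp
  have hσc : ∀ p, latticeCoeff (1 / 4) (1 / 4 - e / 8) (reflectEquiv e p) =
      latticeCoeff (1 / 4) (1 / 4 - e / 8) p := by
    rintro ⟨m, n⟩
    simp only [latticeCoeff, reflectEquiv, Equiv.coe_fn_mk]
    rcases he with rfl | rfl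
    · congr 1; push_cast; ring
    · rw [← Real.cos_add_int_mul_two_pi _ (-m)]
      congr 1; push_cast; ring
  refine mem_accumSet_of_eventually (i := 2) (j := j) (by norm_num) hj
    (isOpen_vertical e) ⟨him, ?_, ?_⟩ fun ε hε => ?_
  · rw [hre]
    nlinarith
  · rw [hre]
    nlinarith
  rw [ha, hjb]
  have hz := eventually_exists_zero_on_tie (abs_latticeCoeff_le (1 / 4) (1 / 4 - e / 8))
    (latticeCoeff_neg _ _) (q₁ := (1, 0)) (q₂ := (1, e))
    (by rcases he with rfl | rfl <;> norm_num)
    (by rw [hc1]; rcases he with rfl | rfl <;> simp) (by rw [hc1, hc2])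
    (reflectEquiv e) hσc (fun w _ htie => ⟨1, fun p => ?_⟩) (fun w => ?_) him
    ((vertical_tie_iff he).2 hre) (dominated_of_vertical he hre h1 h2) hε
  · filter_upwards [hz] with l ⟨w, hw, h0, htie⟩
    refine ⟨w, hw, h0, fun hU => mem_closedFundDomain_iff.2 ⟨hU.1, ?_, hU.2.2.le⟩⟩
    rw [(vertical_tie_iff he).1 htie]
    rcases he with rfl | rfl <;> norm_num
  · have hw := (vertical_tie_iff he).1 htie
    have hconj : (starRingEnd ℂ) w = -e - w := by
      apply Complex.ext
      · simp [hw]; ring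
      · simp
    simp only [linForm, reflectEquiv, Equiv.coe_fn_mk, map_add, map_mul, map_intCast, hconj]
    push_cast
    ring
  · simp only [linForm, reflectEquiv, Equiv.coe_fn_mk]
    rcases he with rfl | rfl <;> push_cast <;> ring

theorem lowBoundary_subset_accumSet {M : ℕ} (hM : 2 ≤ M) : lowBoundary ⊆ accumSet (4 * M) := by
  rintro z ⟨hz, hn⟩
  obtain ⟨hzF, hbd⟩ := mem_frontier_closedFundDomain_iff.1 hz
  obtain ⟨him, hre, hn1⟩ := mem_closedFundDomain_iff.1 hzF
  rw [norm_lt_iff_sq zero_le_two] at hn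
  rcases hbd with h | h
  · exact arcs_subset_accumSet (by omega) (mem_arcs_iff.2 ⟨him, hre, h⟩)
  obtain ⟨e, he, hze⟩ : ∃ e : ℤ, (e = 1 ∨ e = -1) ∧ z.re = -e / 2 := by
    rcases (abs_eq (by norm_num)).1 h with h | h
    · exact ⟨-1, .inr rfl, by rw [h]; norm_num⟩
    · exact ⟨1, .inl rfl, by rw [h]; norm_num⟩
  have hre2 : z.re ^ 2 = 1 / 4 := by rw [← sq_abs, h]; norm_num
  have hf : Continuous fun y : ℝ => ((-e / 2 : ℝ) : ℂ) + (y : ℂ) * Complex.I := by fun_prop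
  have hzx : z = ((-e / 2 : ℝ) : ℂ) + (z.im : ℂ) * Complex.I := by
    rw [← hze, Complex.re_add_im]
  rw [hzx]
  have hs1 : √(3 / 4) ^ 2 = 3 / 4 := Real.sq_sqrt (by norm_num)
  have hs2 : √(15 / 4) ^ 2 = 15 / 4 := Real.sq_sqrt (by norm_num)
  refine mem_accumSet_of_Ioo hf (a := √(3 / 4)) (b := √(15 / 4))
    (Real.sqrt_lt_sqrt (by norm_num) (by norm_num)) ?_
    ⟨Real.sqrt_le_iff.2 ⟨him.le, by linarith⟩, Real.le_sqrt_of_sq_le (by linarith)⟩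
  intro y hy
  have hy0 : 0 < y := (Real.sqrt_nonneg _).trans_lt hy.1
  have hy1 : 3 / 4 < y ^ 2 := (Real.sqrt_lt' hy0).1 hy.1
  have hy2 : y ^ 2 < 15 / 4 := (Real.lt_sqrt hy0.le).1 hy.2
  have hwre : (((-e / 2 : ℝ) : ℂ) + (y : ℂ) * Complex.I).re = -e / 2 := by simp
  have hwim : (((-e / 2 : ℝ) : ℂ) + (y : ℂ) * Complex.I).im = y := by simp
  rcases eq_or_lt_of_le hM with rfl | hM3
  · exact mem_accumSet_vertical_eight he (by rwa [hwim]) hwre (by rwa [hwim]) (by rwa [hwim])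
  · exact mem_accumSet_vertical_of_three_le hM3 he (by rwa [hwim]) hwre (by rwa [hwim])
      (by rwa [hwim])

/-! ### Arithmetic of the index and assembly -/

theorem cos_two_pi_mul_div_ne_zero {N : ℕ} (hN : 0 < N) (h4 : ¬ 4 ∣ N) (i : ℕ) :
    Real.cos (2 * Real.pi * (i / N)) ≠ 0 := by
  intro h
  obtain ⟨k, hk⟩ := Real.cos_eq_zero_iff.1 h
  have hN' : (N : ℝ) ≠ 0 := by exact_mod_cast hN.ne'
  have hpi := Real.pi_ne_zero
  field_simp at hk
  have h1 : (4 * i : ℤ) = (2 * k + 1) * N := by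
    have : (4 * i : ℝ) = (2 * k + 1) * N := by linarith
    exact_mod_cast this
  -- A zero of the cosine gives 4i = (2k + 1)N, and 4 is coprime to the odd factor.
  have h2 : IsCoprime (4 : ℤ) (2 * k + 1) := by
    have : IsCoprime (2 : ℤ) (2 * k + 1) := ⟨-k, 1, by ring⟩
    simpa using this.pow_left (m := 2)
  have h3 : (4 : ℤ) ∣ N := h2.dvd_of_dvd_mul_left (Dvd.intro _ h1)
  exact h4 (by exact_mod_cast h3)

/-- A criterion for the limit configuration of the principal congruence subgroups. -/
theorem isLimitConfiguration_Gamma {N : ℕ} (hN : 0 < N) {L : Set ℂ} (hL : L ⊆ accumSet N)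
    (h : ∀ z ∈ closedFundDomain, z ∉ L → ∀ v : Fin 2 → ZMod N,
      ∃ q, IsDominant (latticeCoeff ((v 0).val / N) ((v 1).val / N)) z q) :
    IsLimitConfiguration (CongruenceSubgroup.Gamma N) L := by
  obtain ⟨K, hK, hXK⟩ := exists_compact_eventually_zeroSet_subset hN
  exact isSetLimit_of_local hK hXK
    (fun z hz => exists_ball_disjoint_zeroSet hN fun hzF => h z hzF hz) hL

theorem one_lt_of_notMem_arcs {z : ℂ} (hz : z ∈ closedFundDomain) (h : z ∉ leftArc ∪ rightArc) :
    1 < z.re ^ 2 + z.im ^ 2 := by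
  obtain ⟨h1, h2, h3⟩ := mem_closedFundDomain_iff.1 hz
  exact h3.lt_of_ne' fun h4 => h (mem_arcs_iff.2 ⟨h1, h2, h4⟩)

theorem ne_four_of_notMem_middleArc {z : ℂ} (hz : z ∈ closedFundDomain) (h : z ∉ middleArc) :
    z.re ^ 2 + z.im ^ 2 ≠ 4 :=
  fun h4 => h ⟨hz, (norm_eq_iff_sq zero_le_two).2 (by rw [h4]; norm_num)⟩

end EisZeros

theorem mainTheorem6 (N : ℕ) (hN : 0 < N) :
    (¬ 4 ∣ N → EisZeros.IsLimitConfiguration (CongruenceSubgroup.Gamma N)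
      (EisZeros.leftArc ∪ EisZeros.rightArc)) ∧
    (4 ∣ N → N ≠ 4 → EisZeros.IsLimitConfiguration (CongruenceSubgroup.Gamma N)
      (EisZeros.lowBoundary ∪ EisZeros.middleArc ∪ EisZeros.sideArcs ∪ EisZeros.imagSegment)) ∧
    (N = 4 → EisZeros.IsLimitConfiguration (CongruenceSubgroup.Gamma N)
      (EisZeros.leftArc ∪ EisZeros.rightArc ∪ EisZeros.middleArc ∪ EisZeros.sideArcs ∪
        EisZeros.imagSegment)) := by
  open EisZeros in
  refine ⟨fun h4 => ?_, fun h4 hne => ?_, fun h4 => ?_⟩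
  · refine isLimitConfiguration_Gamma hN (arcs_subset_accumSet hN) fun z hzF hz v => ?_
    exact ⟨_, isDominant_zero_one (cos_two_pi_mul_div_ne_zero hN h4 _) hzF
      (one_lt_of_notMem_arcs hzF hz)⟩
  · obtain ⟨M, rfl⟩ := h4
    have hM : 0 < M := by omega
    refine isLimitConfiguration_Gamma hN (Set.union_subset (Set.union_subset (Set.union_subset
      (lowBoundary_subset_accumSet (by omega)) (middleArc_subset_accumSet hM))
      (sideArcs_subset_accumSet hM)) (imagSegment_subset_accumSet hM)) fun z hzF hz v => ?_
    simp only [Set.mem_union, not_or] at hz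
    obtain ⟨⟨⟨hlow, hmid⟩, hside⟩, himag⟩ := hz
    obtain ⟨him, hre, hn⟩ := mem_closedFundDomain_iff.1 hzF
    by_cases ha : Real.cos (2 * Real.pi * ((v 0).val / (4 * M : ℕ))) = 0
    · by_cases hb : Real.cos (2 * Real.pi * ((v 1).val / (4 * M : ℕ))) = 0
      · exact exists_isDominant_of_cos_eq_zero ha hb hzF hside himag
      · refine exists_isDominant_of_cos_ne_zero ha hb hzF (ne_four_of_notMem_middleArc hzF hmid)
          fun hlt _ => hre.lt_of_ne fun h => hlow ⟨?_, ?_⟩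
        · exact mem_frontier_closedFundDomain_iff.2 ⟨hzF, .inr h⟩
        · exact (norm_lt_iff_sq zero_le_two).2 (by linarith)
    · refine ⟨_, isDominant_zero_one ha hzF (hn.lt_of_ne' fun h => hlow ⟨?_, ?_⟩)⟩
      · exact mem_frontier_closedFundDomain_iff.2 ⟨hzF, .inl h⟩
      · exact (norm_lt_iff_sq zero_le_two).2 (by linarith)
  · subst h4
    have hmidL : middleArc ⊆ accumSet 4 := middleArc_subset_accumSet (M := 1) one_pos
    have hsideL : sideArcs ⊆ accumSet 4 := sideArcs_subset_accumSet (M := 1) one_pos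
    have himagL : imagSegment ⊆ accumSet 4 := imagSegment_subset_accumSet (M := 1) one_pos
    refine isLimitConfiguration_Gamma hN (Set.union_subset (Set.union_subset (Set.union_subset
      (arcs_subset_accumSet hN) hmidL) hsideL) himagL)
      fun z hzF hz v => ?_
    rw [Set.mem_union, Set.mem_union, Set.mem_union, not_or, not_or, not_or] at hz
    obtain ⟨⟨⟨harc, hmid⟩, hside⟩, himag⟩ := hz
    by_cases ha : Real.cos (2 * Real.pi * ((v 0).val / (4 : ℕ))) = 0
    · by_cases hb : Real.cos (2 * Real.pi * ((v 1).val / (4 : ℕ))) = 0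
      · exact exists_isDominant_of_cos_eq_zero ha hb hzF hside himag
      · refine exists_isDominant_of_cos_ne_zero ha hb hzF (ne_four_of_notMem_middleArc hzF hmid)
          fun _ hs => absurd ?_ hs
        -- For N = 4 the angle 4πb is a multiple of π, so sin 2πb · cos 2πb = 0. Thus cos 2πb ≠ 0
        -- leaves only even translates, and the vertical lines do not occur.
        have h1 := Real.sin_two_mul (2 * Real.pi * ((v 1).val / (4 : ℕ)))
        rw [show 2 * (2 * Real.pi * ((v 1).val / (4 : ℕ))) = ((v 1).val : ℕ) * Real.pi by
          push_cast; ring, Real.sin_nat_mul_pi] at h1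
        exact (mul_eq_zero.1 ((mul_eq_zero.1 h1.symm).resolve_right hb)).resolve_left two_ne_zero
    · exact ⟨_, isDominant_zero_one ha hzF (one_lt_of_notMem_arcs hzF harc)⟩
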